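/- Notation. $\mathcal K^n_o$ is the set of compact convex sets $K\subset\mathbb R^n$ with non-empty interior and with $o\in K$; $h_K(u)=\max_{x\in K}\langle u,x\rangle$ is the support function; $\mathcal H^k$ is the $k$-dimensional Hausdorff measure normalized so that it coincides with Lebesgue measure on $k$-dimensional affine subspaces. Let $\partial'K$ be the set of boundary points of $K$ with a unique exterior unit normal vector $\nu_K(x)$. The surface area measure of $K$ is the Borel measure on $\mathbb S^{n-1}$ given by $S_K(\eta)=\mathcal H^{n-1}(\nu_K^{-1}(\eta))$ for Borel sets $\eta\subset \mathbb S^{n-1}$, and for $p<1$ the $L_p$ surface area measure is $dS_{p,K}=h_K^{1-p}\,dS_K$. Theorem 1.4. Let $p<1$, let $n,m$ be integers with $0\le m\le n-2$, and let $L\subset\mathbb R^n$ be an $(m+1)$-dimensional linear subspace. (i) Suppose $n-2m-p\ge 0$. If $K\in\mathcal K^n_o$ satisfies $\operatorname{supp} S_{p,K}\subset L$, and the restriction of $S_{p,K}$ to the Borel subsets of $\mathbb S^{n-1}\cap L$ equals $\varphi\,d\mathcal H^m$ for a measurable function $\varphi:\mathbb S^{n-1}\cap L\to[0,\infty)$,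 then $\operatorname{ess\,inf}\varphi=0$, where the essential infimum is taken with respect to $\mathcal H^m$ on $\mathbb S^{n-1}\cap L$. (ii) Suppose $n-2m-p<0$. Then there exist $K\in\mathcal K^n_o$ and a continuous function $\varphi:\mathbb S^{n-1}\cap L\to(0,\infty)$ such that $\operatorname{supp} S_{p,K}\subset L$ and the restriction of $S_{p,K}$ to the Borel subsets of $\mathbb S^{n-1}\cap L$ equals $\varphi\,d\mathcal H^m$. -/

import Mathlib

open scoped MeasureTheory NNReal ENNReal

noncomputable section

namespace LpSurface

open MeasureTheory Metric

/-- Euclidean space `ℝⁿ`. -/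
abbrev E (n : ℕ) : Type := EuclideanSpace ℝ (Fin n)

/-- The unit sphere `S^{n-1}` of `ℝⁿ`. -/
abbrev Sphere (n : ℕ) : Type := sphere (0 : E n) 1

variable {n : ℕ}

/-- The class `K^n_o`: compact convex sets with non-empty interior that contain the origin.
(A Mathlib `ConvexBody` is a non-empty compact convex set.) -/
def IsBodyWithOrigin (K : ConvexBody (E n)) : Prop :=
  (interior (K : Set (E n))).Nonempty ∧ (0 : E n) ∈ K

/-- The support function `h_K(u) = max_{x ∈ K} ⟨u, x⟩`. -/
def supportFunction (K : ConvexBody (E n)) (u : E n) : ℝ :=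
  sSup ((fun x : E n => inner ℝ u x) '' (K : Set (E n)))

/-- `u` is an exterior unit normal vector to `K` at the point `x`. -/
def IsExteriorNormal (K : ConvexBody (E n)) (x : E n) (u : Sphere n) : Prop :=
  ∀ y ∈ K, inner ℝ (u : E n) (y - x) ≤ 0

/-- The set `∂'K` of boundary points of `K` with a unique exterior unit normal vector. -/
def regularBoundary (K : ConvexBody (E n)) : Set (E n) :=
  {x | x ∈ frontier (K : Set (E n)) ∧ ∃! u : Sphere n, IsExteriorNormal K x u}

/-- The spherical Gauss map `ν_K : ∂'K → S^{n-1}`. -/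
def gaussMap (K : ConvexBody (E n)) (x : regularBoundary K) : Sphere n :=
  x.2.2.choose

theorem gaussMap_eq_iff (K : ConvexBody (E n)) (x : regularBoundary K) (u : Sphere n) :
    gaussMap K x = u ↔ IsExteriorNormal K x u := by
  constructor
  · rintro rfl
    exact x.2.2.choose_spec.1
  · intro h
    exact (x.2.2.choose_spec.2 u h).symm

theorem continuous_gaussMap (K : ConvexBody (E n)) : Continuous (gaussMap K) := by
  have hG : IsClosed {q : regularBoundary K × Sphere n | gaussMap K q.1 = q.2} := by
    have h : {q : regularBoundary K × Sphere n | gaussMap K q.1 = q.2} =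
        ⋂ y ∈ K, {q : regularBoundary K × Sphere n |
          inner ℝ (q.2 : E n) (y - (q.1 : E n)) ≤ 0} := by
      ext q
      simp only [Set.mem_ofPred_eq, Set.mem_iInter, gaussMap_eq_iff]
      rfl
    rw [h]
    exact isClosed_biInter fun y _ => isClosed_le (by fun_prop) continuous_const
  refine continuous_iff_isClosed.2 fun F hF => ?_
  have h2 : gaussMap K ⁻¹' F = Prod.fst ''
      ({q : regularBoundary K × Sphere n | gaussMap K q.1 = q.2} ∩ Prod.snd ⁻¹' F) := by
    ext x
    simp
  rw [h2]
  exact isClosedMap_fst_of_compactSpace _ (hG.inter (hF.preimage continuous_snd))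

/-- The surface area measure `S_K` on `S^{n-1}`: the push-forward under the Gauss map of the
`(n-1)`-dimensional Hausdorff measure on `∂'K`. Here `μHE[k]` is the `k`-dimensional Hausdorff
measure, normalized to be Lebesgue measure on `k`-dimensional affine subspaces. -/
def surfaceAreaMeasure (K : ConvexBody (E n)) : Measure (Sphere n) :=
  Measure.map (gaussMap K) (μHE[n - 1] : Measure (regularBoundary K))

/-- `S_K(η) = H^{n-1}(ν_K⁻¹(η))` for Borel sets `η`. -/
theorem surfaceAreaMeasure_apply (K : ConvexBody (E n)) {η : Set (Sphere n)}
    (hη : MeasurableSet η) :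
    surfaceAreaMeasure K η =
      (μHE[n - 1] : Measure (E n)) (Subtype.val '' (gaussMap K ⁻¹' η)) := by
  rw [surfaceAreaMeasure, Measure.map_apply (continuous_gaussMap K).measurable hη,
    isometry_subtype_coe.euclideanHausdorffMeasure_image]

/-- The `L_p` surface area measure `dS_{p,K} = h_K^{1-p} dS_K`, for `p < 1` and a convex body
containing the origin (so that `h_K ≥ 0`). -/
def lpSurfaceAreaMeasure (p : ℝ) (K : ConvexBody (E n)) : Measure (Sphere n) :=
  (surfaceAreaMeasure K).withDensity
    (fun u => ENNReal.ofReal (supportFunction K (u : E n) ^ (1 - p)))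

/-- The great subsphere `S^{n-1} ∩ L`. -/
def subsphere (L : Submodule ℝ (E n)) : Set (Sphere n) :=
  {u | (u : E n) ∈ L}

theorem measurableSet_subsphere (L : Submodule ℝ (E n)) : MeasurableSet (subsphere L) :=
  (L.closed_of_finiteDimensional.preimage continuous_subtype_val).measurableSet

/-- The restriction of the measure `μ` to (the Borel subsets of) `S^{n-1} ∩ L` equals
`φ dH^m`. -/
def HasDensityOn (μ : Measure (Sphere n)) (m : ℕ) (L : Submodule ℝ (E n))
    (φ : subsphere L → ℝ≥0) : Prop :=
  μ.comap (Subtype.val : subsphere L → Sphere n) =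
    (μHE[m] : Measure (subsphere L)).withDensity (fun u => (φ u : ℝ≥0∞))

end LpSurface

end

/-! Put `k = dim Lᗮ = n - m - 1`, so that `n - 2m - p = (1 - p + k) - m`. The sign decides whether
`ε ^ (1 - p + k)`, the scale of the `L_p` area of a cap of radius `ε` about a degenerate normal, is
at most the scale `ε ^ m` of its Hausdorff measure.

Part (i). `K` is cut out by the half-spaces whose normals lie in `L` or have `h_K = 0`, because all
other normals together carry no surface area (`mem_of_forall_inner_le`). Let `C` be the cone given
by the normals with `h_K = 0`. A ray of `C` inside `Lᗮ` would stay in `K`, so compactness gives `C ∩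
Lᗮ = 0`. Separation (`exists_inner_le_neg_mul_norm`) then yields a unit `u₀ ∈ L` with `h_K(u₀) = 0`
and `⟪u₀, x⟫ ≤ -c · dist(x, W)` on `K`, where `W` is the lineality space of `C` and `W ∩ Lᗮ = 0`. At
a boundary point with normal `u ∈ L` within `ε` of `u₀`, `⟪u, x⟫ = h_K(u) ≥ 0` forces `dist(x, W) =
O(ε)`, so a projection to `Lᗮ` killing `W` has size `O(ε)`: `k` directions contribute `ε ^ k`. The
other `m` directions contribute `o(1)`, because the projected points with normals near `u₀`, minus
the projected face of `u₀`, decrease to the empty set. Hence the punctured cap has surface area `o(ε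
^ k)` (`exists_surfaceAreaMeasure_le`). As `h_K = O(ε)` there and `h_K(u₀) = 0`, the cap has `L_p`
area `o(ε ^ (1 - p + k))`. A positive essential infimum would make it at least of order `ε ^ m`
(`le_measure_cap`). The little-o settles the equality case.

Part (ii). Let `w = 1 + ⟪e, u⟫` for a unit `e ∈ L`. The body `coneBody` has support function `w ^ q`
on `L` and, over a point `z` of its projection to `L`, a ball of radius `⟪e, z⟫` as fibre. Normals
outside `L` occur only where the support function vanishes. On `L` the surface density is `w ^ ((q -
1) m)` from the principal radii, times `w ^ (q k)` from the fibres, times a factor bounded away from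
zero; the weight gives `w ^ (q (1 - p))`. The powers cancel for `q = m / (n - p)`, and the remaining
factor is positive also at `w = 0` because `q > 1/2`, that is, `n - 2m - p < 0`. The density is
identified by comparing the boundary locally with a linear image of a product
(`exists_nhds_surfaceAreaMeasure_coneBody`, `eq_withDensity_of_locally`). -/

namespace LpSurface

open MeasureTheory Metric Set Filter Topology

/-! ### Comparison of Hausdorff measures -/

/-- If distances between the values of `f` on `s` are bounded by `C` times the distances between
the values of `g`, then the Hausdorff measure of `f '' s` is bounded by that of `g '' s`. -/
theorem euclideanHausdorffMeasure_image_le_of_dist_le {ι X Y : Type*}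
    [MetricSpace X] [MeasurableSpace X] [BorelSpace X]
    [MetricSpace Y] [MeasurableSpace Y] [BorelSpace Y]
    {f : ι → X} {g : ι → Y} {s : Set ι} {C : ℝ≥0} (d : ℕ)
    (h : ∀ i ∈ s, ∀ j ∈ s, dist (f i) (f j) ≤ C * dist (g i) (g j)) :
    (μHE[d] : Measure X) (f '' s) ≤ (C : ℝ≥0∞) ^ d * (μHE[d] : Measure Y) (g '' s) := by
  rcases isEmpty_or_nonempty ι with hι | hι
  · simp [Set.eq_empty_of_isEmpty s]
  -- On `s`, `f` factors through `g`: equal values of `g` force equal values of `f`, so any choice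
  -- of inverse gives the same map, and it is `C`-Lipschitz.
  set F : Y → X := fun y => f (Function.invFunOn g s y) with hF
  have hinv : ∀ y ∈ g '' s, Function.invFunOn g s y ∈ s ∧ g (Function.invFunOn g s y) = y :=
    fun y hy => ⟨Function.invFunOn_mem hy, Function.invFunOn_eq hy⟩
  have hlip : LipschitzOnWith C F (g '' s) := by
    refine LipschitzOnWith.of_dist_le_mul fun y hy y' hy' => ?_
    have := h _ (hinv y hy).1 _ (hinv y' hy').1
    rwa [(hinv y hy).2, (hinv y' hy').2] at this
  have hsub : f '' s ⊆ F '' (g '' s) := by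
    rintro _ ⟨i, hi, rfl⟩
    refine ⟨g i, ⟨i, hi, rfl⟩, ?_⟩
    have h1 := hinv (g i) ⟨i, hi, rfl⟩
    have h2 := h _ h1.1 _ hi
    rw [h1.2, dist_self, mul_zero] at h2
    exact dist_le_zero.1 h2
  refine (measure_mono hsub).trans ?_
  simp only [Measure.euclideanHausdorffMeasure_def, Measure.smul_apply, Measure.nnreal_smul_coe_apply]
  have := hlip.hausdorffMeasure_image_le (d := d) (by positivity)
  rw [ENNReal.rpow_natCast] at this
  calc _ ≤ _ := mul_le_mul_right this _
    _ = _ := by ring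

/-! ### Support functions and normals -/

variable {n : ℕ} {K : ConvexBody (E n)}

theorem bddAbove_inner_image (K : ConvexBody (E n)) (u : E n) :
    BddAbove ((fun x : E n => inner ℝ u x) '' (K : Set (E n))) :=
  (K.isCompact.image (by fun_prop)).bddAbove

theorem inner_le_supportFunction {x : E n} (hx : x ∈ K) (u : E n) :
    inner ℝ u x ≤ supportFunction K u :=
  le_csSup (bddAbove_inner_image K u) ⟨x, hx, rfl⟩

theorem supportFunction_le {u : E n} {a : ℝ} (h : ∀ x ∈ K, inner ℝ u x ≤ a) :
    supportFunction K u ≤ a := by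
  refine csSup_le (K.nonempty.image _) ?_
  rintro _ ⟨x, hx, rfl⟩
  exact h x hx

theorem supportFunction_nonneg (h0 : (0 : E n) ∈ K) (u : E n) : 0 ≤ supportFunction K u := by
  simpa using inner_le_supportFunction h0 u

theorem isExteriorNormal_iff {x : E n} (hx : x ∈ K) (u : Sphere n) :
    IsExteriorNormal K x u ↔ inner ℝ (u : E n) x = supportFunction K u := by
  constructor
  · intro h
    refine le_antisymm (inner_le_supportFunction hx _) (supportFunction_le fun y hy => ?_)
    have := h y hy
    rw [inner_sub_right] at this
    linarith
  · intro h y hy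
    rw [inner_sub_right, h]
    linarith [inner_le_supportFunction hy (u : E n)]

theorem exists_norm_le (K : ConvexBody (E n)) : ∃ R : ℝ, 0 < R ∧ ∀ x ∈ K, ‖x‖ ≤ R := by
  obtain ⟨R, hR, h⟩ := K.isCompact.isBounded.exists_pos_norm_le
  exact ⟨R, hR, h⟩

/-- A supremum of functionals `⟪·, x⟫` with `‖x‖ ≤ R` is `R`-Lipschitz. -/
theorem continuous_supportFunction (K : ConvexBody (E n)) : Continuous (supportFunction K) := by
  obtain ⟨R, hR, hK⟩ := exists_norm_le K
  have hlip : LipschitzWith ⟨R, hR.le⟩ (supportFunction K) :=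
    LipschitzWith.of_le_add_mul _ fun u v => ?_
  · exact hlip.continuous
  refine supportFunction_le fun x hx => ?_
  have h1 : inner ℝ u x = inner ℝ v x + inner ℝ (u - v) x := by rw [inner_sub_left]; ring
  have h2 : inner ℝ (u - v) x ≤ ‖u - v‖ * R :=
    (real_inner_le_norm _ _).trans (by gcongr; exact hK x hx)
  rw [h1, dist_eq_norm]
  have := inner_le_supportFunction hx v
  change _ ≤ _ + R * _
  linarith

theorem frontier_subset (K : ConvexBody (E n)) {x : E n} (hx : x ∈ frontier (K : Set (E n))) :
    x ∈ K :=
  K.isCompact.isClosed.frontier_subset hx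

theorem mem_frontier_of_isExteriorNormal {x : E n} (hx : x ∈ K) {u : Sphere n}
    (h : IsExteriorNormal K x u) : x ∈ frontier (K : Set (E n)) := by
  rw [K.isCompact.isClosed.frontier_eq]
  refine ⟨hx, fun hint => ?_⟩
  obtain ⟨r, hr, hb⟩ := Metric.mem_nhds_iff.1 (mem_interior_iff_mem_nhds.1 hint)
  have hu : ‖(u : E n)‖ = 1 := norm_eq_of_mem_sphere u
  have h1 : x + (r / 2) • (u : E n) ∈ K := by
    refine hb ?_
    rw [mem_ball, dist_eq_norm, add_sub_cancel_left, norm_smul, hu, Real.norm_of_nonneg (by positivity)]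
    linarith
  have := h _ h1
  rw [add_sub_cancel_left, inner_smul_right, real_inner_self_eq_norm_sq, hu] at this
  linarith

/-- Every boundary point of a convex body with interior points has an exterior normal. -/
theorem exists_isExteriorNormal (hK : (interior (K : Set (E n))).Nonempty) {x : E n}
    (hx : x ∈ frontier (K : Set (E n))) : ∃ u : Sphere n, IsExteriorNormal K x u := by
  have hx' : x ∉ interior (K : Set (E n)) := hx.2
  obtain ⟨f, hf⟩ := geometric_hahn_banach_open_point K.convex.interior isOpen_interior hx'
  set v : E n := (InnerProductSpace.toDual ℝ (E n)).symm f with hv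
  have hfv : ∀ y, f y = inner ℝ v y := fun y => by
    rw [hv, InnerProductSpace.toDual_symm_apply]
  obtain ⟨a, ha⟩ := hK
  have hv0 : v ≠ 0 := by
    intro h0
    have := hf a ha
    simp [hfv, h0] at this
  have hn : 0 < ‖v‖ := norm_pos_iff.2 hv0
  refine ⟨⟨‖v‖⁻¹ • v, by simp [norm_smul, hn.ne']⟩, fun y hy => ?_⟩
  have hcl : y ∈ closure (interior (K : Set (E n))) := by
    rw [K.convex.closure_interior_eq_closure_of_nonempty_interior ⟨a, ha⟩]
    exact subset_closure hy
  have hle : f y ≤ f x := by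
    have : closure (interior (K : Set (E n))) ⊆ {z | f z ≤ f x} :=
      closure_minimal (fun z hz => (hf z hz).le) (isClosed_le f.continuous continuous_const)
    exact this hcl
  rw [hfv, hfv] at hle
  rw [real_inner_smul_left, inner_sub_right]
  exact mul_nonpos_of_nonneg_of_nonpos (by positivity) (by linarith)

theorem gaussMap_isExteriorNormal (K : ConvexBody (E n)) (x : regularBoundary K) :
    IsExteriorNormal K x (gaussMap K x) :=
  (gaussMap_eq_iff K x _).1 rfl

theorem inner_gaussMap (K : ConvexBody (E n)) (x : regularBoundary K) :
    inner ℝ (gaussMap K x : E n) (x : E n) = supportFunction K (gaussMap K x) :=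
  (isExteriorNormal_iff (frontier_subset K x.2.1) _).1 (gaussMap_isExteriorNormal K x)

/-- The points of `∂'K` whose normal lies in `η`. -/
theorem image_gaussMap_preimage (K : ConvexBody (E n)) (η : Set (Sphere n)) :
    Subtype.val '' (gaussMap K ⁻¹' η) =
      {x : E n | ∃ hx : x ∈ regularBoundary K, gaussMap K ⟨x, hx⟩ ∈ η} := by
  ext x
  constructor
  · rintro ⟨y, hy, rfl⟩
    exact ⟨y.2, hy⟩
  · rintro ⟨hx, h⟩
    exact ⟨⟨x, hx⟩, h, rfl⟩

theorem measurable_lpWeight (p : ℝ) (K : ConvexBody (E n)) :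
    Measurable fun u : Sphere n => ENNReal.ofReal (supportFunction K (u : E n) ^ (1 - p)) :=
  (((continuous_supportFunction K).comp continuous_subtype_val).measurable.pow_const _).ennreal_ofReal

end LpSurface

namespace LpSurface

open MeasureTheory Metric Set Filter Topology

/-! ### A convex body is determined by its normals at regular boundary points -/

variable {n : ℕ} {K : ConvexBody (E n)}

theorem inner_lt_supportFunction {x : E n} (hx : x ∈ interior (K : Set (E n))) (u : Sphere n) :
    inner ℝ (u : E n) x < supportFunction K u := by
  refine lt_of_le_of_ne (inner_le_supportFunction (interior_subset hx) _) fun h => ?_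
  exact (mem_frontier_of_isExteriorNormal (interior_subset hx)
    ((isExteriorNormal_iff (interior_subset hx) u).2 h)).2 hx

/-- A boundary point at which the boundary is the graph of a differentiable function has
only one exterior unit normal. -/
theorem mem_regularBoundary_of_differentiableAt (hK : (interior (K : Set (E n))).Nonempty)
    {v a : E n} {g : (ℝ ∙ v)ᗮ → ℝ} {y : (ℝ ∙ v)ᗮ} (hd : DifferentiableAt ℝ g y)
    (hg : ∀ᶠ y' : (ℝ ∙ v)ᗮ in 𝓝 y, a + (y' : E n) + g y' • v ∈ K)
    (hb : a + (y : E n) + g y • v ∈ frontier (K : Set (E n)))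
    (hint : a + (y : E n) ∈ interior (K : Set (E n))) (hg0 : 0 ≤ g y) :
    a + (y : E n) + g y • v ∈ regularBoundary K := by
  refine ⟨hb, ?_⟩
  -- The interior point `a + y` differs from the boundary point by a nonnegative multiple of `v`, so
  -- a normal must increase strictly along `v`.
  have hpos : ∀ u : Sphere n, IsExteriorNormal K (a + (y : E n) + g y • v) u →
      0 < inner ℝ (u : E n) v := by
    intro u hu
    have h1 := (isExteriorNormal_iff (frontier_subset K hb) u).1 hu
    have h2 := inner_lt_supportFunction hint u
    rw [← h1, inner_add_right _ _ (g y • v), inner_smul_right] at h2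
    by_contra! h3
    nlinarith [mul_nonneg hg0 (neg_nonneg.2 h3)]
  -- The linear functional of a normal has a local maximum on the graph; its vanishing derivative
  -- determines the part of `u` orthogonal to `v` from `⟪u, v⟫`.
  have hder : ∀ u : Sphere n, IsExteriorNormal K (a + (y : E n) + g y • v) u →
      ∀ d : (ℝ ∙ v)ᗮ, inner ℝ (u : E n) (d : E n) + fderiv ℝ g y d * inner ℝ (u : E n) v = 0 := by
    intro u hu d
    set F : (ℝ ∙ v)ᗮ → ℝ := fun y' => inner ℝ (u : E n) (y' : E n) + g y' * inner ℝ (u : E n) v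
      with hF
    have hmax : IsLocalMax F y := by
      filter_upwards [hg] with y' hy'
      have := hu _ hy'
      simp only [inner_sub_right, inner_add_right, inner_smul_right] at this
      simp only [hF]
      linarith
    have hFd : HasFDerivAt F ((innerSL ℝ (u : E n)).comp (Submodule.subtypeL (ℝ ∙ v)ᗮ) +
        (inner ℝ (u : E n) v) • fderiv ℝ g y) y := by
      refine HasFDerivAt.add ?_ (hd.hasFDerivAt.mul_const _)
      exact ((innerSL ℝ (u : E n)).comp (Submodule.subtypeL (ℝ ∙ v)ᗮ)).hasFDerivAt
    have h0 := congrArg (fun A => A d) (hmax.hasFDerivAt_eq_zero hFd)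
    simp only [add_apply, ContinuousLinearMap.comp_apply, smul_apply, smul_eq_mul] at h0
    simp at h0
    linarith
  obtain ⟨u, hu⟩ := exists_isExteriorNormal hK hb
  refine ⟨u, hu, fun u' hu' => ?_⟩
  set w : E n := inner ℝ (u : E n) v • (u' : E n) - inner ℝ (u' : E n) v • (u : E n) with hw
  have hwv : inner ℝ v w = 0 := by
    rw [hw, inner_sub_right, inner_smul_right, inner_smul_right, real_inner_comm (u : E n) v,
      real_inner_comm (u' : E n) v]
    ring
  have hwH : w ∈ (ℝ ∙ v)ᗮ := Submodule.mem_orthogonal_singleton_iff_inner_right.2 hwv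
  have hww : inner ℝ w w = 0 := by
    have h1 := hder u hu ⟨w, hwH⟩
    have h2 := hder u' hu' ⟨w, hwH⟩
    simp only at h1 h2
    have : inner ℝ w w = inner ℝ (u : E n) v * inner ℝ (u' : E n) w
        - inner ℝ (u' : E n) v * inner ℝ (u : E n) w := by
      nth_rewrite 1 [hw]
      rw [inner_sub_left, real_inner_smul_left, real_inner_smul_left]
    rw [this]
    linear_combination (inner ℝ (u : E n) v) * h2 - (inner ℝ (u' : E n) v) * h1
  have hw0 : inner ℝ (u : E n) v • (u' : E n) = inner ℝ (u' : E n) v • (u : E n) :=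
    sub_eq_zero.1 (inner_self_eq_zero.1 hww)
  have hn := congrArg norm hw0
  rw [norm_smul, norm_smul, norm_eq_of_mem_sphere, norm_eq_of_mem_sphere,
    Real.norm_of_nonneg (hpos u hu).le, Real.norm_of_nonneg (hpos u' hu').le, mul_one, mul_one] at hn
  rw [hn] at hw0
  exact Subtype.ext (smul_right_injective _ (hpos u' hu').ne' hw0)

/-- A convex body with interior points is the intersection of the supporting half-spaces with
normals in `P`, if `P` has full surface area measure. -/
theorem mem_of_forall_inner_le (hK : (interior (K : Set (E n))).Nonempty) {P : Set (Sphere n)}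
    (hPm : MeasurableSet P) (hP : surfaceAreaMeasure K Pᶜ = 0) {x : E n}
    (hx : ∀ u ∈ P, inner ℝ (u : E n) x ≤ supportFunction K u) : x ∈ K := by
  -- Near the segment from an interior point `a` to `x ∉ K`, the boundary is the graph of a concave
  -- `g` over a ball in `vᗮ`. Its normals there lie outside `P`, so its regular points are null,
  -- although by Rademacher they project onto almost all of the ball.
  by_contra hxK
  obtain ⟨a, ha⟩ := id hK
  obtain ⟨r, hr, hball⟩ := Metric.isOpen_iff.1 isOpen_interior a ha
  set v := x - a with hv
  have hv0 : v ≠ 0 := by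
    intro h
    rw [hv, sub_eq_zero] at h
    exact hxK (h ▸ interior_subset ha)
  have hvn : 0 < ‖v‖ ^ 2 := by positivity
  have hvH : ∀ y : (ℝ ∙ v)ᗮ, inner ℝ v (y : E n) = 0 := fun y =>
    Submodule.mem_orthogonal_singleton_iff_inner_right.1 y.2
  set S : (ℝ ∙ v)ᗮ → Set ℝ := fun y => {s | a + (y : E n) + s • v ∈ K} with hS
  set g : (ℝ ∙ v)ᗮ → ℝ := fun y => sSup (S y) with hgdef
  have hbdd : ∀ y, BddAbove (S y) := fun y => by
    refine ⟨(supportFunction K v - inner ℝ v a) / ‖v‖ ^ 2, fun s hs => ?_⟩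
    have := inner_le_supportFunction hs v
    rw [inner_add_right, inner_add_right, inner_smul_right, hvH, real_inner_self_eq_norm_sq] at this
    rw [le_div_iff₀ hvn]
    linarith
  have hint : ∀ y ∈ ball (0 : (ℝ ∙ v)ᗮ) r, a + (y : E n) ∈ interior (K : Set (E n)) := fun y hy =>
    hball (by simpa [dist_eq_norm] using hy)
  have hzero : ∀ y ∈ ball (0 : (ℝ ∙ v)ᗮ) r, (0 : ℝ) ∈ S y := fun y hy => by
    simpa [hS] using interior_subset (hint y hy)
  have hmem : ∀ y ∈ ball (0 : (ℝ ∙ v)ᗮ) r, a + (y : E n) + g y • v ∈ K := fun y hy => by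
    have hcl : IsClosed (S y) := K.isCompact.isClosed.preimage (by fun_prop)
    exact hcl.csSup_mem ⟨0, hzero y hy⟩ (hbdd y)
  have hnonneg : ∀ y ∈ ball (0 : (ℝ ∙ v)ᗮ) r, 0 ≤ g y := fun y hy =>
    le_csSup (hbdd y) (hzero y hy)
  have hconc : ConcaveOn ℝ (ball (0 : (ℝ ∙ v)ᗮ) r) g := by
    refine ⟨convex_ball _ _, fun y hy y' hy' s t hs ht hst => ?_⟩
    refine le_csSup (hbdd _) ?_
    have := K.convex (hmem y hy) (hmem y' hy') hs ht hst
    simp only [hS, mem_ofPred_eq]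
    convert! this using 1
    have : a = (s + t) • a := by rw [hst, one_smul]
    push_cast
    nth_rewrite 1 [this]
    simp only [smul_eq_mul]
    module
  have h0r : (0 : (ℝ ∙ v)ᗮ) ∈ ball (0 : (ℝ ∙ v)ᗮ) r := mem_ball_self hr
  have hg1 : g 0 < 1 := by
    by_contra! h1
    refine hxK ?_
    have h2 := hmem 0 h0r
    have h3 : g 0 ≠ 0 := by linarith
    have := K.convex (interior_subset ha) h2 (a := 1 - (g 0)⁻¹) (b := (g 0)⁻¹)
      (by rw [sub_nonneg]; exact inv_le_one_of_one_le₀ h1) (by positivity) (by ring)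
    convert! this using 1
    simp only [Submodule.coe_zero, add_zero, smul_add, smul_smul, inv_mul_cancel₀ h3, hv]
    module
  -- A level strictly between `g 0` and `1`: for `g y < σ` and `‖y‖ < (1 - σ) r`, the rescaled point
  -- `(1 - g y)⁻¹ • y` stays in the ball of radius `r`.
  set σ := (1 + g 0) / 2 with hσ
  have hσ1 : σ < 1 := by rw [hσ]; linarith
  have hopen : IsOpen (ball (0 : (ℝ ∙ v)ᗮ) r) := isOpen_ball
  have hcont : ∀ᶠ y in 𝓝 (0 : (ℝ ∙ v)ᗮ), g y < σ :=
    ((hconc.continuousOn hopen).continuousAt (hopen.mem_nhds h0r)).eventually_lt_const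
      (by rw [hσ]; linarith)
  obtain ⟨C, t, ht, hC⟩ := (hconc.locallyLipschitzOn hopen) h0r
  rw [hopen.nhdsWithin_eq h0r] at ht
  obtain ⟨ρ, hρ, hρsub⟩ := Metric.mem_nhds_iff.1 (inter_mem (inter_mem hcont ht)
    (ball_mem_nhds (0 : (ℝ ∙ v)ᗮ) (show 0 < (1 - σ) * r from mul_pos (by linarith) hr)))
  have hσ0 : 0 < σ := by have := hnonneg 0 h0r; rw [hσ]; linarith
  have hρr : ∀ y ∈ ball (0 : (ℝ ∙ v)ᗮ) ρ, y ∈ ball (0 : (ℝ ∙ v)ᗮ) r := fun y hy => by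
    refine ball_subset_ball ?_ (hρsub hy).2
    nlinarith
  set b : (ℝ ∙ v)ᗮ → E n := fun y => a + (y : E n) + g y • v with hb
  have hfront : ∀ y ∈ ball (0 : (ℝ ∙ v)ᗮ) r, b y ∈ frontier (K : Set (E n)) := fun y hy => by
    rw [K.isCompact.isClosed.frontier_eq]
    refine ⟨hmem y hy, fun hi => ?_⟩
    have hlim : Tendsto (fun s : ℝ => a + (y : E n) + s • v) (𝓝[>] (g y)) (𝓝 (b y)) := by
      refine tendsto_nhdsWithin_of_tendsto_nhds ?_
      exact Continuous.tendsto (by fun_prop) _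
    obtain ⟨s, hs, hsg⟩ := ((hlim.eventually (mem_interior_iff_mem_nhds.1 hi)).and
      self_mem_nhdsWithin).exists
    exact absurd (le_csSup (hbdd y) hs) (not_le.2 hsg)
  -- `b y` is a convex combination of `x` and an interior point, the latter with positive weight. A
  -- normal in `P` would therefore have inner product with `b y` strictly below the support value.
  have hnormal : ∀ y ∈ ball (0 : (ℝ ∙ v)ᗮ) ρ, ∀ u, IsExteriorNormal K (b y) u → u ∉ P := by
    intro y hy u hu huP
    have hgy : g y < σ := (hρsub hy).1.1
    have hc : 0 < 1 - g y := by linarith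
    have h1 := (isExteriorNormal_iff (hmem y (hρr y hy)) u).1 hu
    have hz : a + (1 - g y)⁻¹ • (y : E n) ∈ interior (K : Set (E n)) := by
      refine hball ?_
      rw [mem_ball, dist_eq_norm, add_sub_cancel_left, norm_smul, norm_inv,
        Real.norm_of_nonneg hc.le, inv_mul_lt_iff₀ hc]
      have h2 : ‖(y : E n)‖ < (1 - σ) * r := by simpa using (hρsub hy).2
      refine h2.trans_le ?_
      gcongr
    have h2 := inner_lt_supportFunction hz u
    have h3 : b y = (1 - g y) • (a + (1 - g y)⁻¹ • (y : E n)) + g y • x := by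
      simp only [hb, smul_add, smul_smul, mul_inv_cancel₀ hc.ne', hv]
      module
    change inner ℝ (u : E n) (b y) = _ at h1
    rw [h3, inner_add_right, inner_smul_right, inner_smul_right] at h1
    nlinarith [hx u huP, hnonneg y (hρr y hy), mul_lt_mul_of_pos_left h2 hc,
      mul_le_mul_of_nonneg_left (hx u huP) (hnonneg y (hρr y hy))]
  have hfin : Module.finrank ℝ (ℝ ∙ v)ᗮ = n - 1 := by
    have := (ℝ ∙ v).finrank_add_finrank_orthogonal
    rw [finrank_span_singleton hv0, finrank_euclideanSpace_fin] at this
    omega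
  set Y : Set (ℝ ∙ v)ᗮ := {y | y ∈ ball (0 : (ℝ ∙ v)ᗮ) ρ ∧ b y ∈ regularBoundary K} with hY
  have hnull : (volume : Measure (ℝ ∙ v)ᗮ) Y = 0 := by
    rw [← InnerProductSpace.euclideanHausdorffMeasure_eq_volume, hfin]
    have h1 := euclideanHausdorffMeasure_image_le_of_dist_le (f := id) (g := b) (s := Y) (C := 1)
      (n - 1) (fun y _ y' _ => by
        have : b y - b y' = ((y - y' : (ℝ ∙ v)ᗮ) : E n) + (g y - g y') • v := by
          simp only [hb]; push_cast; module
        rw [id, id, dist_eq_norm, dist_eq_norm, this, NNReal.coe_one, one_mul, Submodule.coe_norm]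
        refine le_of_sq_le_sq ?_ (norm_nonneg _) 
        rw [@norm_add_sq_real, inner_smul_right, real_inner_comm, hvH]
        nlinarith [sq_nonneg ‖(g y - g y') • v‖])
    rw [image_id] at h1
    refine le_antisymm (h1.trans ?_) zero_le
    rw [surfaceAreaMeasure_apply K hPm.compl, image_gaussMap_preimage] at hP
    rw [measure_mono_null _ hP, mul_zero]
    rintro _ ⟨y, ⟨hy, hreg⟩, rfl⟩
    exact ⟨hreg, hnormal y hy _ (gaussMap_isExteriorNormal K ⟨_, hreg⟩)⟩
  have hlip : LipschitzOnWith C g (ball (0 : (ℝ ∙ v)ᗮ) ρ) := hC.mono fun y hy => (hρsub hy).1.2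
  have hae := hlip.ae_differentiableWithinAt_of_mem (μ := (volume : Measure (ℝ ∙ v)ᗮ))
  have hsub : ball (0 : (ℝ ∙ v)ᗮ) ρ ≤ᵐ[volume] Y := by
    filter_upwards [hae] with y hy hyρ
    have hyρ' : y ∈ ball (0 : (ℝ ∙ v)ᗮ) ρ := hyρ
    refine ⟨hyρ', mem_regularBoundary_of_differentiableAt hK
      ((hy hyρ').differentiableAt (isOpen_ball.mem_nhds hyρ')) ?_ (hfront y (hρr y hyρ'))
      (hint y (hρr y hyρ')) (hnonneg y (hρr y hyρ'))⟩
    filter_upwards [isOpen_ball.mem_nhds hyρ'] with y' hy'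
    exact hmem y' (hρr y' hy')
  have h0 : (volume : Measure (ℝ ∙ v)ᗮ) (ball (0 : (ℝ ∙ v)ᗮ) ρ) = 0 :=
    le_antisymm ((measure_mono_ae hsub).trans hnull.le) zero_le
  exact (Metric.measure_ball_pos volume _ hρ).ne' h0

end LpSurface

namespace LpSurface

open MeasureTheory Metric Set Filter Topology

/-! ### Lineality spaces of closed convex cones -/

section Cone

variable {V : Type*} [NormedAddCommGroup V] [InnerProductSpace ℝ V] [FiniteDimensional ℝ V]

/-- In a finite-dimensional space the convex hull of a compact set is compact. -/
theorem isCompact_convexHull_of_isCompact {s : Set V} (hs : IsCompact s) :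
    IsCompact (convexHull ℝ s) := by
  rcases s.eq_empty_or_nonempty with rfl | ⟨b, hb⟩
  · simp
  let ι := Fin (Module.finrank ℝ V + 1)
  let Φ : (ι → ℝ) × (ι → V) → V := fun q => ∑ i, q.1 i • q.2 i
  have hΦ : Continuous Φ := by fun_prop
  suffices h : convexHull ℝ s = Φ '' (stdSimplex ℝ ι ×ˢ Set.pi univ fun _ => s) by
    rw [h]
    exact ((isCompact_stdSimplex ℝ ι).prod (isCompact_univ_pi fun _ => hs)).image hΦ
  refine Subset.antisymm (fun x hx => ?_) ?_
  -- Carathéodory: at most `dim + 1` points are needed; unused slots get weight zero and the point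
  -- `b`.
  · obtain ⟨κ, _, z, w, hz, hind, hw, hw1, rfl⟩ := eq_pos_convex_span_of_mem_convexHull hx
    have hcard : Fintype.card κ ≤ Fintype.card ι := by
      rw [Fintype.card_fin]
      refine hind.card_le_finrank_succ.trans ?_
      gcongr
      exact Submodule.finrank_le _
    obtain ⟨j⟩ := Function.Embedding.nonempty_of_card_le hcard
    refine ⟨(Function.extend j w 0, Function.extend j z fun _ => b), ⟨⟨fun i => ?_, ?_⟩, ?_⟩, ?_⟩
    · by_cases hi : ∃ a, j a = i
      · obtain ⟨a, rfl⟩ := hi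
        simpa [j.injective.extend_apply] using (hw a).le
      · simp [Function.extend_apply' _ _ _ hi]
    · rw [← hw1]
      refine (Fintype.sum_of_injective j j.injective _ _ (fun i hi => ?_) fun i => ?_).symm
      · exact Function.extend_apply' _ _ _ hi
      · exact (j.injective.extend_apply _ _ _).symm
    · intro i _
      by_cases hi : ∃ a, j a = i
      · obtain ⟨a, rfl⟩ := hi
        simpa [j.injective.extend_apply] using hz ⟨a, rfl⟩
      · simpa [Function.extend_apply' _ _ _ hi] using hb
    · refine (Fintype.sum_of_injective j j.injective _ _ (fun i hi => ?_) fun i => ?_).symm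
      · have h0 : Function.extend j w 0 i = 0 := Function.extend_apply' _ _ _ hi
        simp only [h0, zero_smul]
      · simp only [j.injective.extend_apply]
  · rintro _ ⟨q, ⟨hq1, hq2⟩, rfl⟩
    exact (convex_convexHull ℝ s).sum_mem (fun i _ => hq1.1 i) hq1.2
      fun i _ => subset_convexHull ℝ s (hq2 i (mem_univ i))

/-- The lineality space of a convex cone. -/
def linealitySpace (C : ConvexCone ℝ V) (h0 : (0 : V) ∈ C) : Submodule ℝ V where
  carrier := {x | x ∈ C ∧ -x ∈ C}
  zero_mem' := by simpa using h0
  add_mem' := by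
    rintro x y ⟨hx, hx'⟩ ⟨hy, hy'⟩
    refine ⟨C.add_mem hx hy, ?_⟩
    rw [neg_add]
    exact C.add_mem hx' hy'
  smul_mem' := by
    rintro t x ⟨hx, hx'⟩
    rcases lt_trichotomy t 0 with ht | rfl | ht
    · refine ⟨?_, ?_⟩
      · simpa using C.smul_mem (neg_pos.2 ht) hx'
      · simpa using C.smul_mem (neg_pos.2 ht) hx
    · simpa using h0
    · refine ⟨C.smul_mem ht hx, ?_⟩
      simpa using C.smul_mem ht hx'

/-- If a closed convex cone meets `Lᗮ` only at the origin, then some vector of `L` is nonpositive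
on the cone, quantitatively in terms of the distance from the lineality space. -/
theorem exists_inner_le_neg_mul_norm {C : ConvexCone ℝ V} (h0 : (0 : V) ∈ C)
    (hCc : IsClosed (C : Set V)) {L : Submodule ℝ V} (hCL : ∀ x ∈ C, x ∈ Lᗮ → x = 0) :
    ∃ u ∈ L, u ∈ (linealitySpace C h0)ᗮ ∧ ∃ c : ℝ, 0 < c ∧
      ∀ x ∈ C, inner ℝ u x ≤ -(c * ‖x - (linealitySpace C h0).starProjection x‖) := by
  set W := linealitySpace C h0 with hW
  set D : Set V := {x | x ∈ C ∧ x ∈ Wᗮ ∧ x ≠ 0} with hD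
  -- Only `x ≠ 0` could fail; cancellation would make `-x` a positive multiple of `y ∈ C`, placing
  -- `x` in both `W` and `Wᗮ`.
  have hDconv : Convex ℝ D := by
    refine convex_iff_forall_pos.2 fun x hx y hy s t hs ht _ => ?_
    refine ⟨C.add_mem (C.smul_mem hs hx.1) (C.smul_mem ht hy.1),
      Wᗮ.add_mem (Wᗮ.smul_mem _ hx.2.1) (Wᗮ.smul_mem _ hy.2.1), fun h => hx.2.2 ?_⟩
    have hxW : x ∈ W := by
      refine ⟨hx.1, ?_⟩
      have h1 : -x = (t / s) • y := by
        have h2 : s • x = -(t • y) := eq_neg_of_add_eq_zero_left h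
        rw [div_eq_inv_mul, mul_smul, ← neg_eq_iff_eq_neg.2 h2, smul_neg, smul_smul,
          inv_mul_cancel₀ hs.ne', one_smul]
      rw [h1]
      exact C.smul_mem (div_pos ht hs) hy.1
    exact inner_self_eq_zero.1 (Submodule.inner_right_of_mem_orthogonal hxW hx.2.1)
  set B : Set V := {x | x ∈ C ∧ x ∈ Wᗮ ∧ ‖x‖ = 1} with hB
  have hBD : B ⊆ D := fun x hx => ⟨hx.1, hx.2.1, fun h => by simpa [h] using hx.2.2⟩
  have hBcomp : IsCompact B := by
    have : B = ((C : Set V) ∩ Wᗮ) ∩ sphere (0 : V) 1 := by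
      ext x
      simp [hB, and_assoc]
    rw [this]
    exact (isCompact_sphere _ _).inter_left (hCc.inter W.isClosed_orthogonal)
  have hsub : ∀ x ∈ C, x - W.starProjection x ∈ C ∧ x - W.starProjection x ∈ Wᗮ := fun x hx => by
    refine ⟨?_, W.sub_starProjection_mem_orthogonal x⟩
    rw [sub_eq_add_neg]
    exact C.add_mem hx (W.starProjection_apply_mem x).2
  -- If `l + w ∈ D` with `l ∈ Lᗮ` and `w ∈ W`, then `l = (l + w) - w ∈ C`, so `l = 0`, and the point
  -- lies in `W ∩ Wᗮ`.
  have hdisj : Disjoint (convexHull ℝ B) ((Lᗮ ⊔ W : Submodule ℝ V) : Set V) := by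
    refine Set.disjoint_left.2 fun x hx hxV => ?_
    have hxD : x ∈ D := convexHull_min hBD hDconv hx
    obtain ⟨l, hl, w, hw, rfl⟩ := Submodule.mem_sup.1 hxV
    have hlC : l ∈ C := by
      have := C.add_mem hxD.1 hw.2
      simpa using this
    have hl0 := hCL l hlC hl
    rw [hl0, zero_add] at hxD
    exact hxD.2.2 (inner_self_eq_zero.1 (Submodule.inner_right_of_mem_orthogonal hw hxD.2.1))
  obtain ⟨f, s, t, hfs, hst, hft⟩ := geometric_hahn_banach_compact_closed (convex_convexHull ℝ B)
    (isCompact_convexHull_of_isCompact hBcomp) (Lᗮ ⊔ W).convex (Submodule.closed_of_finiteDimensional _) hdisj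
  have ht0 : t < 0 := by simpa using hft 0 (Submodule.zero_mem _)
  -- A functional bounded below on a subspace vanishes there. Since `s < t < 0`, the functional is
  -- at most `s` on unit vectors of `C ∩ Wᗮ`, which provides the constant `-s`.
  have hf0 : ∀ x ∈ Lᗮ ⊔ W, f x = 0 := fun x hx => by
    by_contra hne
    have := hft _ ((Lᗮ ⊔ W).smul_mem (t / f x) hx)
    rw [map_smul, smul_eq_mul, div_mul_cancel₀ _ hne] at this
    exact lt_irrefl _ this
  set u : V := (InnerProductSpace.toDual ℝ V).symm f with hu
  have hfu : ∀ y, inner ℝ u y = f y := fun y => by rw [hu, InnerProductSpace.toDual_symm_apply]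
  refine ⟨u, ?_, ?_, -s, by linarith, fun x hx => ?_⟩
  · rw [← L.orthogonal_orthogonal, Submodule.mem_orthogonal']
    intro y hy
    rw [hfu, hf0 y (Submodule.mem_sup_left hy)]
  · rw [Submodule.mem_orthogonal']
    intro y hy
    rw [hfu, hf0 y (Submodule.mem_sup_right hy)]
  · obtain ⟨h1, h2⟩ := hsub x hx
    have h3 : inner ℝ u x = inner ℝ u (x - W.starProjection x) := by
      rw [inner_sub_right, hfu (W.starProjection x),
        hf0 _ (Submodule.mem_sup_right (W.starProjection_apply_mem x)), sub_zero]
    rw [h3]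
    set z := x - W.starProjection x with hz
    rcases eq_or_ne z 0 with hz0 | hz0
    · simp [hz0]
    have hzn : 0 < ‖z‖ := norm_pos_iff.2 hz0
    have hzB : ‖z‖⁻¹ • z ∈ B := ⟨C.smul_mem (inv_pos.2 hzn) h1, Wᗮ.smul_mem _ h2, by
      rw [norm_smul, norm_inv, norm_norm, inv_mul_cancel₀ hzn.ne']⟩
    have h4 := hfs _ (subset_convexHull ℝ B hzB)
    rw [map_smul, smul_eq_mul, inv_mul_lt_iff₀ hzn] at h4
    rw [hfu]
    linarith

end Cone

end LpSurface

namespace LpSurface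

open MeasureTheory Metric Set Filter Topology

/-! ### Surface area near a degenerate normal -/

/-- The Euclidean Hausdorff measure of a product of two subsets of Euclidean spaces. -/
theorem euclideanHausdorffMeasure_toLp_image_prod {X Y : Type*}
    [NormedAddCommGroup X] [InnerProductSpace ℝ X] [FiniteDimensional ℝ X] [MeasurableSpace X]
    [BorelSpace X] [NormedAddCommGroup Y] [InnerProductSpace ℝ Y] [FiniteDimensional ℝ Y]
    [MeasurableSpace Y] [BorelSpace Y] (s : Set X) (t : Set Y) :
    (μHE[Module.finrank ℝ X + Module.finrank ℝ Y] : Measure (WithLp 2 (X × Y)))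
      (WithLp.toLp 2 '' (s ×ˢ t)) = volume s * volume t := by
  have hfin : Module.finrank ℝ X + Module.finrank ℝ Y = Module.finrank ℝ (WithLp 2 (X × Y)) := by
    rw [(WithLp.linearEquiv 2 ℝ (X × Y)).finrank_eq, Module.finrank_prod]
  rw [hfin, InnerProductSpace.euclideanHausdorffMeasure_eq_volume, ← Measure.prod_prod]
  refine Eq.trans ?_ ((WithLp.volume_preserving_symm_measurableEquiv_toLp_prod
    X Y).measure_preimage_equiv (s ×ˢ t))
  congr 1
  ext x
  constructor
  · rintro ⟨y, hy, rfl⟩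
    exact hy
  · intro hx
    exact ⟨_, hx, rfl⟩

variable {n : ℕ} {K : ConvexBody (E n)}

/-- Points whose normals are within `ε` of `u₀` differ little in the direction `u₀`. -/
theorem abs_inner_sub_le {u₀ : E n} {ε : ℝ} {x x' : E n} {u u' : Sphere n} (hx : x ∈ K)
    (hx' : x' ∈ K) (hu : IsExteriorNormal K x u) (hu' : IsExteriorNormal K x' u')
    (h : ‖(u : E n) - u₀‖ ≤ ε) (h' : ‖(u' : E n) - u₀‖ ≤ ε) :
    |inner ℝ u₀ (x - x')| ≤ ε * ‖x - x'‖ := by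
  -- Replacing `u₀` by a true normal `w` costs at most `ε * ‖d‖`, and `w` is nonpositive on `d`.
  have key : ∀ (w : Sphere n) (d : E n), ‖(w : E n) - u₀‖ ≤ ε → inner ℝ (w : E n) d ≤ 0 →
      inner ℝ u₀ d ≤ ε * ‖d‖ := by
    intro w d hw hd
    have h1 : inner ℝ u₀ d = inner ℝ (w : E n) d - inner ℝ ((w : E n) - u₀) d := by
      rw [inner_sub_left]; ring
    have h2 : |inner ℝ ((w : E n) - u₀) d| ≤ ‖(w : E n) - u₀‖ * ‖d‖ := abs_real_inner_le_norm _ _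
    have h3 : ‖(w : E n) - u₀‖ * ‖d‖ ≤ ε * ‖d‖ := by gcongr
    have := neg_abs_le (inner ℝ ((w : E n) - u₀) d)
    linarith
  rw [abs_le]
  constructor
  · have := key u (x' - x) h (hu x' hx')
    rw [← neg_sub x x', inner_neg_right, norm_neg] at this
    linarith
  · exact key u' (x - x') h' (hu' x hx)

/-- Points with normals in `L` close to `u₀ ∈ L` have the same components in `L` if they have the
same components orthogonal to `u₀`. -/
theorem inner_sub_eq_zero {L : Submodule ℝ (E n)} {u₀ : E n} (hu₀ : u₀ ∈ L) (hn : ‖u₀‖ = 1)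
    {x x' : E n} {u u' : Sphere n} (hx : x ∈ K) (hx' : x' ∈ K) (hu : IsExteriorNormal K x u)
    (hu' : IsExteriorNormal K x' u') (huL : (u : E n) ∈ L) (huL' : (u' : E n) ∈ L)
    (h : ‖(u : E n) - u₀‖ < 1) (h' : ‖(u' : E n) - u₀‖ < 1)
    (hd : ∀ l ∈ (ℝ ∙ u₀)ᗮ ⊓ L, inner ℝ l (x - x') = 0) :
    ∀ l ∈ L, inner ℝ l (x - x') = 0 := by
  have hL : ∀ l ∈ L, inner ℝ l (x - x') = inner ℝ l u₀ * inner ℝ u₀ (x - x') := by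
    intro l hl
    have h1 : l - inner ℝ l u₀ • u₀ ∈ (ℝ ∙ u₀)ᗮ ⊓ L := by
      refine ⟨Submodule.mem_orthogonal_singleton_iff_inner_left.2 ?_, L.sub_mem hl (L.smul_mem _ hu₀)⟩
      rw [inner_sub_left, real_inner_smul_left, real_inner_self_eq_norm_sq, hn]
      ring
    have := hd _ h1
    rw [inner_sub_left, real_inner_smul_left] at this
    linarith
  have hpos : ∀ w : Sphere n, ‖(w : E n) - u₀‖ < 1 → 0 < inner ℝ (w : E n) u₀ := by
    intro w hw
    have h1 : |inner ℝ ((w : E n) - u₀) u₀| ≤ ‖(w : E n) - u₀‖ * ‖u₀‖ := abs_real_inner_le_norm _ _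
    rw [inner_sub_left, real_inner_self_eq_norm_sq, hn] at h1
    have := neg_abs_le (inner ℝ (w : E n) u₀ - 1 ^ 2)
    linarith
  have h1 := hu x' hx'
  have h2 := hu' x hx
  rw [← neg_sub x x', inner_neg_right, hL _ huL] at h1
  rw [hL _ huL'] at h2
  -- Within `L` the difference is a multiple of `u₀`. The two normality inequalities give this
  -- multiple opposite signs, as both normals have positive component along `u₀`.
  have h3 : inner ℝ u₀ (x - x') = 0 := by
    refine le_antisymm ?_ ?_
    · exact nonpos_of_mul_nonpos_right h2 (hpos u' h')
    · exact nonneg_of_mul_nonneg_right (by linarith) (hpos u h)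
  intro l hl
  rw [hL l hl, h3, mul_zero]

/-- The points of `K` with a normal in `L` within `ε` of `u₀`. -/
def nearNormal (K : ConvexBody (E n)) (L : Submodule ℝ (E n)) (u₀ : E n) (ε : ℝ) : Set (E n) :=
  {x | x ∈ K ∧ ∃ u : Sphere n, (u : E n) ∈ L ∧ ‖(u : E n) - u₀‖ ≤ ε ∧ IsExteriorNormal K x u}

theorem isClosed_setOf_isExteriorNormal (K : ConvexBody (E n)) :
    IsClosed {q : E n × Sphere n | IsExteriorNormal K q.1 q.2} := by
  have h : {q : E n × Sphere n | IsExteriorNormal K q.1 q.2} =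
      ⋂ y ∈ K, {q : E n × Sphere n | inner ℝ (q.2 : E n) (y - q.1) ≤ 0} := by
    ext q
    simp only [mem_ofPred_eq, mem_iInter]
    rfl
  rw [h]
  exact isClosed_biInter fun y _ => isClosed_le (by fun_prop) continuous_const

theorem isCompact_nearNormal (K : ConvexBody (E n)) (L : Submodule ℝ (E n)) (u₀ : E n) (ε : ℝ) :
    IsCompact (nearNormal K L u₀ ε) := by
  have h : nearNormal K L u₀ ε = Prod.fst '' ((((K : Set (E n)) ×ˢ univ) ∩
      {q : E n × Sphere n | IsExteriorNormal K q.1 q.2}) ∩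
      ({q : E n × Sphere n | (q.2 : E n) ∈ L} ∩ {q | ‖(q.2 : E n) - u₀‖ ≤ ε})) := by
    ext x
    constructor
    · rintro ⟨hx, u, huL, hu, hn⟩
      exact ⟨(x, u), ⟨⟨⟨hx, mem_univ _⟩, hn⟩, huL, hu⟩, rfl⟩
    · rintro ⟨⟨y, u⟩, ⟨⟨⟨hx, -⟩, hn⟩, huL, hu⟩, rfl⟩
      exact ⟨hx, u, huL, hu, hn⟩
  rw [h]
  refine IsCompact.image ?_ continuous_fst
  refine ((K.isCompact.prod isCompact_univ).inter_right
    (isClosed_setOf_isExteriorNormal K)).inter_right (IsClosed.inter ?_ ?_)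
  · exact L.closed_of_finiteDimensional.preimage (by fun_prop)
  · exact isClosed_le (by fun_prop) continuous_const

theorem nearNormal_mono (K : ConvexBody (E n)) (L : Submodule ℝ (E n)) (u₀ : E n) {ε ε' : ℝ}
    (h : ε ≤ ε') : nearNormal K L u₀ ε ⊆ nearNormal K L u₀ ε' := by
  rintro x ⟨hx, u, huL, hu, hn⟩
  exact ⟨hx, u, huL, hu.trans h, hn⟩

/-- The projections of the boundary points with normals near but different from `u₀` have small
measure. -/
theorem exists_volume_image_nearNormal_lt {L : Submodule ℝ (E n)} {u₀ : Sphere n}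
    (hu₀ : (u₀ : E n) ∈ L) {δ : ℝ≥0∞} (hδ : 0 < δ) :
    ∃ ε : ℝ, 0 < ε ∧ volume
      (((ℝ ∙ (u₀ : E n))ᗮ ⊓ L).orthogonalProjectionOnto '' nearNormal K L u₀ ε \
        ((ℝ ∙ (u₀ : E n))ᗮ ⊓ L).orthogonalProjectionOnto '' {x | x ∈ K ∧ IsExteriorNormal K x u₀})
      < δ := by
  set X := (ℝ ∙ (u₀ : E n))ᗮ ⊓ L with hX
  set F : Set (E n) := {x | x ∈ K ∧ IsExteriorNormal K x u₀} with hF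
  have hn : ‖(u₀ : E n)‖ = 1 := norm_eq_of_mem_sphere u₀
  have hFcomp : IsCompact F := by
    have hcl : IsClosed {x : E n | IsExteriorNormal K x u₀} :=
      (isClosed_setOf_isExteriorNormal K).preimage (f := fun x : E n => (x, u₀)) (by fun_prop)
    exact K.isCompact.inter_right hcl
  -- The shift by two keeps every radius below one, as `inner_sub_eq_zero` requires.
  set e : ℕ → ℝ := fun j => 1 / ((j : ℝ) + 1 + 1) with he
  have hepos : ∀ j, 0 < e j := fun j => by positivity
  have he1 : ∀ j, e j < 1 := fun j => by
    rw [he, div_lt_one (by positivity)]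
    have : (0 : ℝ) ≤ j := by positivity
    linarith
  have heanti : Antitone e := fun i j hij => by
    simp only [he]
    gcongr
  set Y : ℕ → Set X := fun j => X.orthogonalProjectionOnto '' nearNormal K L u₀ (e j) \
    X.orthogonalProjectionOnto '' F with hY
  have hYm : ∀ j, MeasurableSet (Y j) := fun j =>
    ((isCompact_nearNormal K L u₀ (e j)).image (by fun_prop)).measurableSet.diff
      (hFcomp.image (by fun_prop)).measurableSet
  have hYanti : Antitone Y := fun i j hij =>
    sdiff_subset_sdiff_left (image_mono (nearNormal_mono K L u₀ (heanti hij)))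
  have hYfin : volume (Y 0) ≠ ∞ :=
    ((measure_mono sdiff_subset).trans_lt
      ((isCompact_nearNormal K L u₀ (e 0)).image (by fun_prop)).measure_lt_top).ne
  -- Preimages of a common point `y` with normals `u' j → u₀` all have the same `L`-component, so
  -- each `u' j` is a normal at the single point `x`. In the limit `u₀` is one too, and `y` lies in
  -- the removed projection of the face.
  have hempty : ⋂ j, Y j = ∅ := by
    refine eq_empty_of_forall_notMem fun y hy => ?_
    rw [mem_iInter] at hy
    obtain ⟨⟨x, ⟨hx, u, huL, hu, hun⟩, hxy⟩, hyF⟩ := hy 0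
    choose x' hx' hxy' using fun j => (hy j).1
    choose hxK' u' huL' hu' hun' using hx'
    have hnormal : ∀ j, IsExteriorNormal K x (u' j) := by
      intro j z hz
      have h0 : ∀ l ∈ L, inner ℝ l (x - x' j) = 0 := by
        refine inner_sub_eq_zero hu₀ hn hx (hxK' j) hun (hun' j) huL (huL' j)
          (hu.trans_lt (he1 0)) ((hu' j).trans_lt (he1 j)) fun l hl => ?_
        have : X.orthogonalProjectionOnto (x - x' j) = 0 := by
          rw [map_sub, hxy, hxy', sub_self]
        exact Submodule.inner_right_of_mem_orthogonal hl
          (Submodule.orthogonalProjectionOnto_eq_zero_iff.1 this)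
      have h1 := hun' j z hz
      have h2 := h0 _ (huL' j)
      rw [inner_sub_right] at h1 h2 ⊢
      linarith
    have hlim : Tendsto (fun j => u' j) atTop (𝓝 u₀) := by
      rw [tendsto_subtype_rng, tendsto_iff_norm_sub_tendsto_zero]
      refine squeeze_zero (fun j => norm_nonneg _) hu' ?_
      exact (tendsto_add_atTop_iff_nat 1).2 (by simpa [he] using tendsto_one_div_add_atTop_nhds_zero_nat (𝕜 := ℝ))
        |>.congr fun j => by simp [he]
    refine hyF ⟨x, ⟨hx, ?_⟩, hxy⟩
    have hcl : IsClosed {w : Sphere n | IsExteriorNormal K x w} :=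
      (isClosed_setOf_isExteriorNormal K).preimage (f := fun w : Sphere n => (x, w)) (by fun_prop)
    exact hcl.mem_of_tendsto hlim (Eventually.of_forall hnormal)
  have htend := tendsto_measure_iInter_atTop (μ := (volume : Measure X)) (s := Y)
    (fun j => (hYm j).nullMeasurableSet) hYanti ⟨0, hYfin⟩
  rw [hempty, measure_empty] at htend
  obtain ⟨j, hj⟩ := (htend.eventually_lt_const hδ).exists
  exact ⟨e j, hepos j, hj⟩

end LpSurface

/-! ### Small caps around a degenerate normal have small surface area -/

namespace LpSurface

open MeasureTheory Metric Set Filter Topology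

variable {n : ℕ} {K : ConvexBody (E n)}

/-- A linear projection onto `Lᗮ` vanishing on a subspace that meets `Lᗮ` trivially. -/
theorem exists_projection {V : Type*} [NormedAddCommGroup V] [InnerProductSpace ℝ V]
    [FiniteDimensional ℝ V] {L W : Submodule ℝ V} (h : W ⊓ Lᗮ = ⊥) :
    ∃ P : V →L[ℝ] Lᗮ, (∀ l : Lᗮ, P l = l) ∧ ∀ w ∈ W, P w = 0 := by
  obtain ⟨q, hq, hc⟩ := (disjoint_iff.2 h).exists_isCompl
  refine ⟨LinearMap.toContinuousLinearMap (Lᗮ.projectionOnto q hc.symm), fun l => ?_, fun w hw => ?_⟩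
  · exact Submodule.projectionOnto_apply_left hc.symm l
  · exact (Submodule.projectionOnto_apply_eq_zero_iff hc.symm).2 (hq hw)

theorem finrank_orthogonal_span_inf {L : Submodule ℝ (E n)} {m : ℕ}
    (hL : Module.finrank ℝ L = m + 1) {u : E n} (hu : u ∈ L) (hu0 : u ≠ 0) :
    Module.finrank ℝ ((ℝ ∙ u)ᗮ ⊓ L : Submodule ℝ (E n)) = m := by
  refine Submodule.finrank_add_inf_finrank_orthogonal' ((Submodule.span_singleton_le_iff_mem _ _).2 hu) ?_
  rw [finrank_span_singleton hu0, hL, add_comm]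

/-- A vector orthogonal to `u ∈ L` and to `(ℝ ∙ u)ᗮ ⊓ L` is orthogonal to `L`. -/
theorem mem_orthogonal_of_projection_eq_zero {L : Submodule ℝ (E n)} {u d : E n} (hu : u ∈ L)
    (hn : ‖u‖ = 1) (h0 : inner ℝ u d = 0)
    (hd : ((ℝ ∙ u)ᗮ ⊓ L).orthogonalProjectionOnto d = 0) : d ∈ Lᗮ := by
  rw [Submodule.mem_orthogonal]
  intro l hl
  rw [Submodule.orthogonalProjectionOnto_eq_zero_iff, Submodule.mem_orthogonal] at hd
  have h1 : l - inner ℝ l u • u ∈ (ℝ ∙ u)ᗮ ⊓ L := by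
    refine ⟨Submodule.mem_orthogonal_singleton_iff_inner_left.2 ?_, L.sub_mem hl (L.smul_mem _ hu)⟩
    rw [inner_sub_left, real_inner_smul_left, real_inner_self_eq_norm_sq, hn]
    ring
  have := hd _ h1
  rwa [inner_sub_left, real_inner_smul_left, h0, mul_zero, sub_zero] at this

/-- The surface area of the part of the boundary with normals in `L` near, but different from, a
normal `u₀ ∈ L` at which `K` degenerates to a cone over a subspace. -/
theorem exists_surfaceAreaMeasure_le {m k : ℕ} {L : Submodule ℝ (E n)}
    (hL : Module.finrank ℝ L = m + 1) (hk : Module.finrank ℝ Lᗮ = k) {u₀ : Sphere n}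
    (hu₀ : (u₀ : E n) ∈ L) (h0K : (0 : E n) ∈ K)
    {W : Submodule ℝ (E n)} (hWL : W ⊓ Lᗮ = ⊥) (hWu : (u₀ : E n) ∈ Wᗮ) {c : ℝ} (hc : 0 < c)
    (hcK : ∀ x ∈ K, inner ℝ (u₀ : E n) x ≤ -(c * ‖x - W.starProjection x‖))
    {δ : ℝ} (hδ : 0 < δ) :
    ∃ ε₀ : ℝ, 0 < ε₀ ∧ ∀ ε : ℝ, 0 < ε → ε ≤ ε₀ →
      surfaceAreaMeasure K {u | (u : E n) ∈ L ∧ u ≠ u₀ ∧ ‖(u : E n) - u₀‖ ≤ ε} ≤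
        ENNReal.ofReal (δ * ε ^ k) := by
  have hn : ‖(u₀ : E n)‖ = 1 := norm_eq_of_mem_sphere u₀
  have hu0 : (u₀ : E n) ≠ 0 := norm_ne_zero_iff.1 (by rw [hn]; exact one_ne_zero)
  obtain ⟨R, hR, hRK⟩ := exists_norm_le K
  have hWL' : (W ⊔ (ℝ ∙ (u₀ : E n))) ⊓ Lᗮ = ⊥ := by
    refine (Submodule.eq_bot_iff _).2 fun x hx => ?_
    obtain ⟨hx, hxL⟩ := hx
    obtain ⟨w, hw, z, hz, rfl⟩ := Submodule.mem_sup.1 hx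
    obtain ⟨s, rfl⟩ := Submodule.mem_span_singleton.1 hz
    have h1 := Submodule.inner_right_of_mem_orthogonal hu₀ hxL
    rw [inner_add_right, inner_smul_right, Submodule.inner_left_of_mem_orthogonal hw hWu,
      real_inner_self_eq_norm_sq, hn] at h1
    have hs : s = 0 := by linarith
    rw [hs, zero_smul, add_zero] at hxL ⊢
    have : w ∈ W ⊓ Lᗮ := ⟨hw, hxL⟩
    rwa [hWL, Submodule.mem_bot] at this
  obtain ⟨P, hPid, hPW⟩ := exists_projection hWL'
  set X := (ℝ ∙ (u₀ : E n))ᗮ ⊓ L with hX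
  have hXfin : Module.finrank ℝ X = m := finrank_orthogonal_span_inf hL hu₀ hu0
  have hnmk : n - 1 = Module.finrank ℝ X + Module.finrank ℝ Lᗮ := by
    have := L.finrank_add_finrank_orthogonal
    rw [finrank_euclideanSpace_fin] at this
    omega
  -- the boundary is flat near `u₀`, so that it can be compared with its projection
  let T : E n →ₗ[ℝ] WithLp 2 (X × Lᗮ) × ℝ :=
    LinearMap.prod ((WithLp.linearEquiv 2 ℝ (X × Lᗮ)).symm.toLinearMap ∘ₗ
      LinearMap.prod X.orthogonalProjectionOnto.toLinearMap P.toLinearMap)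
      (innerSL ℝ (u₀ : E n)).toLinearMap
  have hT : LinearMap.ker T = ⊥ := by
    refine LinearMap.ker_eq_bot'.2 fun d hd => ?_
    have h1 : X.orthogonalProjectionOnto d = 0 := congrArg (fun z => z.1.fst) hd
    have h2 : P d = 0 := congrArg (fun z => z.1.snd) hd
    have h3 : inner ℝ (u₀ : E n) d = 0 := congrArg (fun z => z.2) hd
    have h4 := mem_orthogonal_of_projection_eq_zero hu₀ hn h3 h1
    have h5 := hPid ⟨d, h4⟩
    rw [h2] at h5
    exact (congrArg Subtype.val h5).symm
  obtain ⟨C, hC0, hC⟩ := T.exists_antilipschitzWith hT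
  set ψ : E n → WithLp 2 (X × Lᗮ) := fun x => (T x).1 with hψ
  set M : ℝ := ‖P‖ * R / c with hM
  have hM0 : 0 ≤ M := by positivity
  set b : ℝ≥0∞ := volume (closedBall (0 : Lᗮ) 1) with hb
  have hbfin : b ≠ ∞ := measure_closedBall_lt_top.ne
  -- The total constant of the final estimate, from the Lipschitz factor and the `Lᗮ`-ball of radius
  -- `M * ε`. It may be zero, hence the division by `A + 1`.
  set A : ℝ := (2 * C) ^ (n - 1) * (M ^ k * b.toReal) with hA
  have hA0 : 0 ≤ A := by positivity
  obtain ⟨ε₁, hε₁, hvol⟩ := exists_volume_image_nearNormal_lt (K := K) hu₀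
    (δ := ENNReal.ofReal (δ / (A + 1))) (by rw [ENNReal.ofReal_pos]; positivity)
  -- `1 / 2` keeps normals within distance one of `u₀`; `1 / (2 * C)` lets the `u₀`-component of a
  -- difference be absorbed, making `ψ` injective with `2 * C`-Lipschitz inverse on `B`.
  refine ⟨min ε₁ (min (1 / 2) (1 / (2 * C))), by positivity, fun ε hε hεle => ?_⟩
  have hε1 : ε ≤ ε₁ := hεle.trans (min_le_left _ _)
  have hε2 : ε ≤ 1 / 2 := hεle.trans ((min_le_right _ _).trans (min_le_left _ _))
  have hε3 : C * ε ≤ 1 / 2 := by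
    have h1 : ε ≤ 1 / (2 * C) := hεle.trans ((min_le_right _ _).trans (min_le_right _ _))
    rw [le_div_iff₀ (by positivity)] at h1
    linarith
  have hηm : MeasurableSet {u : Sphere n | (u : E n) ∈ L ∧ u ≠ u₀ ∧ ‖(u : E n) - u₀‖ ≤ ε} := by
    refine (measurableSet_subsphere L).inter (MeasurableSet.inter (measurableSet_singleton u₀).compl ?_)
    exact (isClosed_le (f := fun u : Sphere n => ‖(u : E n) - u₀‖) (by fun_prop)
      continuous_const).measurableSet
  rw [surfaceAreaMeasure_apply K hηm, image_gaussMap_preimage]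
  set B := {x : E n | ∃ hx : x ∈ regularBoundary K, gaussMap K ⟨x, hx⟩ ∈
    {u : Sphere n | (u : E n) ∈ L ∧ u ≠ u₀ ∧ ‖(u : E n) - u₀‖ ≤ ε}} with hB
  have hBK : ∀ x ∈ B, x ∈ K := fun x hx => frontier_subset K hx.1.1
  have hdist : ∀ x ∈ B, ∀ x' ∈ B, dist (id x) (id x') ≤ ((2 * C : ℝ≥0) : ℝ) * dist (ψ x) (ψ x') := by
    rintro x ⟨hx, -, -, hxε⟩ x' ⟨hx', -, -, hxε'⟩
    have h1 := hC.le_mul_dist x x'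
    have h2 : dist (T x) (T x') ≤ dist (ψ x) (ψ x') + ε * dist x x' := by
      rw [Prod.dist_eq]
      refine max_le (le_add_of_nonneg_right (by positivity)) ?_
      have h3 : dist (T x).2 (T x').2 ≤ ε * dist x x' := by
        change dist (inner ℝ (u₀ : E n) x) (inner ℝ (u₀ : E n) x') ≤ _
        rw [Real.dist_eq, ← inner_sub_right, dist_eq_norm]
        exact abs_inner_sub_le (frontier_subset K hx.1) (frontier_subset K hx'.1)
          (gaussMap_isExteriorNormal K ⟨x, hx⟩) (gaussMap_isExteriorNormal K ⟨x', hx'⟩) hxε hxε'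
      exact h3.trans (le_add_of_nonneg_left dist_nonneg)
    have h4 : (C : ℝ) * dist (T x) (T x') ≤ C * dist (ψ x) (ψ x') + 1 / 2 * dist x x' := by
      calc (C : ℝ) * dist (T x) (T x') ≤ C * (dist (ψ x) (ψ x') + ε * dist x x') := by gcongr
        _ = C * dist (ψ x) (ψ x') + C * ε * dist x x' := by ring
        _ ≤ _ := by gcongr
    push_cast
    simp only [id]
    linarith
  have hmeas := euclideanHausdorffMeasure_image_le_of_dist_le (n - 1) hdist
  rw [image_id] at hmeas
  set Y := X.orthogonalProjectionOnto '' nearNormal K L u₀ ε₁ \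
    X.orthogonalProjectionOnto '' {x | x ∈ K ∧ IsExteriorNormal K x u₀} with hY
  have hsub : ψ '' B ⊆ WithLp.toLp 2 '' (Y ×ˢ closedBall (0 : Lᗮ) (M * ε)) := by
    rintro _ ⟨x, hxB, rfl⟩
    have hxK := hBK x hxB
    obtain ⟨hx, hxL, hxne, hxε⟩ := hxB
    have hxn := gaussMap_isExteriorNormal K ⟨x, hx⟩
    refine ⟨(X.orthogonalProjectionOnto x, P x), ⟨⟨⟨x, ⟨hxK, _, hxL, hxε.trans hε1, hxn⟩, rfl⟩, ?_⟩, ?_⟩, rfl⟩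
    -- Sharing its projection with a point of the face of `u₀` gives `x` the same `u₀`-height; then
    -- `u₀` is a normal at `x`, against uniqueness of the normal.
    · rintro ⟨y, ⟨hyK, hyn⟩, hyx⟩
      refine hxne ((gaussMap_eq_iff K ⟨x, hx⟩ u₀).2 ?_)
      have h1 : ∀ l ∈ L, inner ℝ l (x - y) = 0 := by
        refine inner_sub_eq_zero hu₀ hn hxK hyK hxn hyn hxL hu₀ (hxε.trans_lt (by linarith))
          (by simp) fun l hl => ?_
        have : X.orthogonalProjectionOnto (x - y) = 0 := by rw [map_sub, hyx, sub_self]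
        exact Submodule.inner_right_of_mem_orthogonal hl
          (Submodule.orthogonalProjectionOnto_eq_zero_iff.1 this)
      have h2 := h1 _ hu₀
      rw [isExteriorNormal_iff hyK] at hyn
      rw [isExteriorNormal_iff hxK]
      rw [inner_sub_right] at h2
      linarith
    · rw [mem_closedBall_zero_iff]
      set w := x - W.starProjection x with hw
      have h1 : P x = P w := by
        rw [hw, map_sub, hPW _ (Submodule.mem_sup_left (W.starProjection_apply_mem x)), sub_zero]
      -- From `0 ≤ h_K(u) = ⟪u, x⟫ ≤ ⟪u₀, x⟫ + ε * R` and the degeneracy bound on `⟪u₀, x⟫`.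
      have h2 : c * ‖w‖ ≤ R * ε := by
        have h3 := hcK x hxK
        have h4 := inner_gaussMap K ⟨x, hx⟩
        have h5 := supportFunction_nonneg h0K (gaussMap K ⟨x, hx⟩ : E n)
        have h6 : inner ℝ ((gaussMap K ⟨x, hx⟩ : E n) - u₀) x ≤ ε * R :=
          (real_inner_le_norm _ _).trans (mul_le_mul hxε (hRK x hxK) (norm_nonneg _) hε.le)
        rw [inner_sub_left] at h6
        simp only at h4
        linarith
      rw [h1]
      calc ‖P w‖ ≤ ‖P‖ * ‖w‖ := P.le_opNorm w
        _ ≤ ‖P‖ * (R * ε / c) := by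
          gcongr
          rw [le_div_iff₀ hc]
          linarith
        _ = M * ε := by rw [hM]; ring
  have hfinal : (μHE[n - 1] : Measure (WithLp 2 (X × Lᗮ))) (ψ '' B) ≤
      ENNReal.ofReal (δ / (A + 1)) * (ENNReal.ofReal ((M * ε) ^ k) * b) := by
    refine (measure_mono hsub).trans ?_
    rw [hnmk, euclideanHausdorffMeasure_toLp_image_prod, Measure.addHaar_closedBall' volume _ (by positivity), hk]
    gcongr
  refine hmeas.trans ((mul_le_mul_right hfinal _).trans ?_)
  rw [← ENNReal.ofReal_toReal hbfin, ← ENNReal.ofReal_coe_nnreal, ← ENNReal.ofReal_pow (by positivity),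
    ← ENNReal.ofReal_mul (by positivity), ← ENNReal.ofReal_mul (by positivity),
    ← ENNReal.ofReal_mul (by positivity)]
  refine ENNReal.ofReal_le_ofReal ?_
  have h1 : A / (A + 1) ≤ 1 := by rw [div_le_one (by positivity)]; linarith
  calc (((2 * C : ℝ≥0) : ℝ)) ^ (n - 1) * (δ / (A + 1) * ((M * ε) ^ k * b.toReal))
      = A / (A + 1) * (δ * ε ^ k) := by rw [hA, mul_pow]; push_cast; ring
    _ ≤ 1 * (δ * ε ^ k) := by gcongr
    _ = δ * ε ^ k := one_mul _

end LpSurface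

/-! ### Existence of a degenerate normal, and the vanishing essential infimum -/

namespace LpSurface

open MeasureTheory Metric Set Filter Topology

variable {n : ℕ} {K : ConvexBody (E n)}

/-- A lower bound for the measure of small caps of the subsphere. -/
theorem le_measure_cap {m : ℕ} {L : Submodule ℝ (E n)} (hL : Module.finrank ℝ L = m + 1)
    {u₀ : Sphere n} (hu₀ : (u₀ : E n) ∈ L) :
    ∃ a : ℝ, 0 < a ∧ ∀ ε : ℝ, 0 < ε → ε ≤ 1 → ENNReal.ofReal (a * ε ^ m) ≤
      (μHE[m] : Measure (subsphere L)) {u | ‖((u : Sphere n) : E n) - u₀‖ ≤ ε} := by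
  have hn : ‖(u₀ : E n)‖ = 1 := norm_eq_of_mem_sphere u₀
  have hu0 : (u₀ : E n) ≠ 0 := norm_ne_zero_iff.1 (by rw [hn]; exact one_ne_zero)
  set X := (ℝ ∙ (u₀ : E n))ᗮ ⊓ L with hX
  have hXfin : Module.finrank ℝ X = m := finrank_orthogonal_span_inf hL hu₀ hu0
  set b : ℝ≥0∞ := volume (closedBall (0 : X) 1) with hb
  have hbfin : b ≠ ∞ := measure_closedBall_lt_top.ne
  have hb0 : 0 < b.toReal := ENNReal.toReal_pos (Metric.measure_closedBall_pos _ _ one_pos).ne' hbfin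
  refine ⟨(1 / 2) ^ m * b.toReal, by positivity, fun ε hε hε1 => ?_⟩
  set S : Set (subsphere L) := {u | ‖((u : Sphere n) : E n) - u₀‖ ≤ ε} with hS
  have h1 := euclideanHausdorffMeasure_image_le_of_dist_le (s := S) (g := id) (C := 1) m
    (f := fun u : subsphere L => X.orthogonalProjectionOnto ((u : Sphere n) : E n))
    (fun u _ v _ => by
      rw [NNReal.coe_one, one_mul, id, id, Subtype.dist_eq u v, Subtype.dist_eq (u : Sphere n),
        dist_eq_norm, dist_eq_norm, ← map_sub]
      exact Submodule.norm_orthogonalProjectionOnto_apply_le X _)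
  rw [image_id, ENNReal.coe_one, one_pow, one_mul] at h1
  refine le_trans ?_ h1
  -- A tangent vector `y` lifts to `y + √(1 - ‖y‖²) • u₀` on the subsphere; halving the radius
  -- ensures that the lift lies in the cap.
  have h2 : closedBall (0 : X) (ε / 2) ⊆
      (fun u : subsphere L => X.orthogonalProjectionOnto ((u : Sphere n) : E n)) '' S := by
    intro y hy
    rw [mem_closedBall_zero_iff] at hy
    have hyu : inner ℝ (u₀ : E n) (y : E n) = 0 :=
      Submodule.mem_orthogonal_singleton_iff_inner_right.1 y.2.1
    have hy' : ‖(y : E n)‖ ≤ ε / 2 := hy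
    have hy0 : 0 ≤ ‖(y : E n)‖ := norm_nonneg _
    set t := Real.sqrt (1 - ‖(y : E n)‖ ^ 2) with ht
    have hy1 : ‖(y : E n)‖ ^ 2 ≤ 1 := by nlinarith
    have ht2 : t ^ 2 = 1 - ‖(y : E n)‖ ^ 2 := Real.sq_sqrt (by linarith)
    have ht0 : 0 ≤ t := Real.sqrt_nonneg _
    set z : E n := (y : E n) + t • (u₀ : E n) with hz
    have hzn : ‖z‖ = 1 := by
      rw [← sq_eq_sq₀ (norm_nonneg _) zero_le_one, hz, @norm_add_sq_real, inner_smul_right,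
        real_inner_comm, hyu, norm_smul, hn, Real.norm_of_nonneg ht0, mul_one, ht2]
      ring
    have hzL : z ∈ L := L.add_mem y.2.2 (L.smul_mem _ hu₀)
    refine ⟨⟨⟨z, by simpa using hzn⟩, hzL⟩, ?_, ?_⟩
    · change ‖z - u₀‖ ≤ ε
      refine le_of_sq_le_sq ?_ hε.le
      have h3 : z - u₀ = (y : E n) + (t - 1) • (u₀ : E n) := by rw [hz]; module
      rw [h3, @norm_add_sq_real, inner_smul_right, real_inner_comm, hyu, norm_smul, hn, mul_one,
        Real.norm_eq_abs, sq_abs]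
      have ht1 : t ≤ 1 := by nlinarith
      nlinarith
    · change X.orthogonalProjectionOnto z = y
      have h4 : X.orthogonalProjectionOnto (u₀ : E n) = 0 := by
        rw [Submodule.orthogonalProjectionOnto_eq_zero_iff, Submodule.mem_orthogonal']
        intro w hw
        exact Submodule.mem_orthogonal_singleton_iff_inner_right.1 hw.1
      rw [hz, map_add, map_smul, h4, smul_zero, add_zero]
      simp
  have h5 := measure_mono (μ := (μHE[m] : Measure X)) h2
  refine le_trans (le_of_eq ?_) h5
  rw [← hXfin, InnerProductSpace.euclideanHausdorffMeasure_eq_volume,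
    Measure.addHaar_closedBall' volume _ (by positivity), hXfin]
  change _ = _ * b
  rw [← ENNReal.ofReal_toReal hbfin, ← ENNReal.ofReal_mul (by positivity)]
  simp only [ENNReal.toReal_ofReal hb0.le]
  congr 1
  rw [div_pow, div_pow]
  ring

/-- The normals in `L`, together with those at which the support function vanishes, have full
surface area measure if the `L_p` surface area measure is supported in `L`. -/
theorem surfaceAreaMeasure_compl_eq_zero {p : ℝ} {L : Submodule ℝ (E n)}
    (h0K : (0 : E n) ∈ K) (hsupp : (lpSurfaceAreaMeasure p K).support ⊆ subsphere L) :
    surfaceAreaMeasure K {u | (u : E n) ∈ L ∨ supportFunction K u = 0}ᶜ = 0 := by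
  have h1 : lpSurfaceAreaMeasure p K (subsphere L)ᶜ = 0 :=
    measure_mono_null (compl_subset_compl.2 hsupp) Measure.measure_compl_support
  rw [lpSurfaceAreaMeasure, withDensity_apply_eq_zero (measurable_lpWeight p K)] at h1
  refine measure_mono_null (fun u hu => ?_) h1
  rw [mem_compl_iff, mem_ofPred_eq, not_or] at hu
  refine ⟨?_, hu.1⟩
  have : 0 < supportFunction K (u : E n) :=
    lt_of_le_of_ne (supportFunction_nonneg h0K _) (Ne.symm hu.2)
  exact (ENNReal.ofReal_pos.2 (Real.rpow_pos_of_pos this _)).ne'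

theorem measurableSet_setOf_mem_or_supportFunction_eq_zero (K : ConvexBody (E n))
    (L : Submodule ℝ (E n)) :
    MeasurableSet {u : Sphere n | (u : E n) ∈ L ∨ supportFunction K u = 0} := by
  refine (measurableSet_subsphere L).union ?_
  exact (isClosed_eq ((continuous_supportFunction K).comp continuous_subtype_val)
    continuous_const).measurableSet

/-- If the `L_p` surface area measure is supported in a proper subspace `L`, then there is a
normal `u₀ ∈ L` at the origin, along which `K` degenerates to a cone over a subspace. -/
theorem exists_degenerate_normal {p : ℝ} {L : Submodule ℝ (E n)}
    (hLtop : Lᗮ ≠ ⊥) (hK : IsBodyWithOrigin K)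
    (hsupp : (lpSurfaceAreaMeasure p K).support ⊆ subsphere L) :
    ∃ u₀ : Sphere n, (u₀ : E n) ∈ L ∧ supportFunction K u₀ = 0 ∧ ∃ W : Submodule ℝ (E n),
      W ⊓ Lᗮ = ⊥ ∧ (u₀ : E n) ∈ Wᗮ ∧ ∃ c : ℝ, 0 < c ∧
        ∀ x ∈ K, inner ℝ (u₀ : E n) x ≤ -(c * ‖x - W.starProjection x‖) := by
  obtain ⟨hint, h0K⟩ := hK
  let C : ConvexCone ℝ (E n) :=
    { carrier := {x | ∀ u : Sphere n, supportFunction K u = 0 → inner ℝ (u : E n) x ≤ 0}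
      smul_mem' := fun t ht x hx u hu => by
        rw [inner_smul_right]
        exact mul_nonpos_of_nonneg_of_nonpos ht.le (hx u hu)
      add_mem' := fun x hx y hy u hu => by
        rw [inner_add_right]
        exact add_nonpos (hx u hu) (hy u hu) }
  have hC0 : (0 : E n) ∈ C := fun u _ => by simp
  have hKC : ∀ x ∈ K, x ∈ C := fun x hx u hu => hu ▸ inner_le_supportFunction hx _
  have hCcl : IsClosed (C : Set (E n)) := by
    have : (C : Set (E n)) = ⋂ u : Sphere n, ⋂ _ : supportFunction K u = 0,
        {x | inner ℝ (u : E n) x ≤ 0} := by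
      ext x
      simp only [mem_iInter]
      rfl
    rw [this]
    exact isClosed_biInter fun u _ => isClosed_le (by fun_prop) continuous_const
  have hCL : ∀ x ∈ C, x ∈ Lᗮ → x = 0 := by
    intro x hx hxL
    obtain ⟨R, hR, hRK⟩ := exists_norm_le K
    by_contra hx0
    have hxn : 0 < ‖x‖ := norm_pos_iff.2 hx0
    -- Normals in `L` vanish on `Lᗮ` and normals with `h_K = 0` are nonpositive on `C`, so the whole
    -- ray satisfies the constraints defining `K`; norm `2 * R` is already too long.
    have hmem : ((2 * R) / ‖x‖) • x ∈ K := by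
      refine mem_of_forall_inner_le hint (measurableSet_setOf_mem_or_supportFunction_eq_zero K L)
        (surfaceAreaMeasure_compl_eq_zero h0K hsupp) fun u hu => ?_
      rw [inner_smul_right]
      rcases hu with hu | hu
      · rw [Submodule.inner_right_of_mem_orthogonal hu hxL, mul_zero]
        exact supportFunction_nonneg h0K _
      · rw [hu]
        exact mul_nonpos_of_nonneg_of_nonpos (by positivity) (hx u hu)
    have := hRK _ hmem
    rw [norm_smul, Real.norm_of_nonneg (by positivity), div_mul_cancel₀ _ hxn.ne'] at this
    linarith
  obtain ⟨u, huL, huW, c, hc, hcu⟩ := exists_inner_le_neg_mul_norm hC0 hCcl hCL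
  set W := linealitySpace C hC0 with hW
  have hWL : W ⊓ Lᗮ = ⊥ := (Submodule.eq_bot_iff _).2 fun x hx => hCL x hx.1.1 hx.2
  -- For `u = 0` the bound puts `K` inside `W`, so `W` is everything, which `W ⊓ Lᗮ = ⊥` and `Lᗮ ≠
  -- ⊥` exclude.
  have hu0 : u ≠ 0 := by
    rintro rfl
    have hWtop : W = ⊤ := by
      refine W.eq_top_of_nonempty_interior' (hint.mono (interior_mono fun x hx => ?_))
      have h1 := hcu x (hKC x hx)
      rw [inner_zero_left] at h1
      have h2 : ‖x - W.starProjection x‖ = 0 := by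
        refine le_antisymm ?_ (norm_nonneg _)
        by_contra! h3
        have := mul_pos hc h3
        linarith
      rw [norm_eq_zero, sub_eq_zero] at h2
      rw [h2]
      exact W.starProjection_apply_mem x
    rw [hWtop, top_inf_eq] at hWL
    exact hLtop hWL
  have hun : 0 < ‖u‖ := norm_pos_iff.2 hu0
  have hle : ∀ x ∈ K, inner ℝ (‖u‖⁻¹ • u) x ≤ -(c / ‖u‖ * ‖x - W.starProjection x‖) := by
    intro x hx
    have := mul_le_mul_of_nonneg_left (hcu x (hKC x hx)) (inv_pos.2 hun).le
    rw [real_inner_smul_left]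
    refine this.trans (le_of_eq ?_)
    ring
  refine ⟨⟨‖u‖⁻¹ • u, by simp [norm_smul, hun.ne']⟩, L.smul_mem _ huL, ?_, W, hWL,
    Wᗮ.smul_mem _ huW, c / ‖u‖, by positivity, hle⟩
  refine le_antisymm (supportFunction_le fun x hx => (hle x hx).trans ?_) (supportFunction_nonneg h0K _)
  have : 0 ≤ c / ‖u‖ * ‖x - W.starProjection x‖ := by positivity
  linarith

/-- If `n - 2m - p ≥ 0`, then a density of the `L_p` surface area measure on an
`(m+1)`-dimensional subspace that supports it is not bounded away from zero. -/
theorem essInf_density_eq_zero {m : ℕ} (hm : m + 2 ≤ n) {p : ℝ} (hp : p < 1)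
    {L : Submodule ℝ (E n)} (hL : Module.finrank ℝ L = m + 1)
    (hnmp : 0 ≤ (n : ℝ) - 2 * (m : ℝ) - p) {φ : subsphere L → ℝ≥0} (hK : IsBodyWithOrigin K)
    (hsupp : (lpSurfaceAreaMeasure p K).support ⊆ subsphere L)
    (hdens : HasDensityOn (lpSurfaceAreaMeasure p K) m L φ) :
    essInf (fun u => (φ u : ℝ≥0∞)) (μHE[m] : Measure (subsphere L)) = 0 := by
  by_contra hne
  obtain ⟨c, hc0, hc⟩ := ENNReal.lt_iff_exists_nnreal_btwn.1 (pos_iff_ne_zero.2 hne)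
  have hc0' : 0 < (c : ℝ) := by exact_mod_cast hc0
  have hae := ae_lt_of_lt_essInf hc
  obtain ⟨k, hk⟩ : ∃ k, Module.finrank ℝ Lᗮ = k := ⟨_, rfl⟩
  have hnk : n = m + 1 + k := by
    have := L.finrank_add_finrank_orthogonal
    rw [finrank_euclideanSpace_fin] at this
    omega
  have hLtop : Lᗮ ≠ ⊥ := by
    intro h
    rw [h, finrank_bot] at hk
    omega
  obtain ⟨u₀, hu₀, h0, W, hWL, hWu, c', hc', hcK⟩ := exists_degenerate_normal hLtop hK hsupp
  obtain ⟨a, ha, hcap⟩ := le_measure_cap hL hu₀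
  obtain ⟨R, hR, hRK⟩ := exists_norm_le K
  have hq : 0 < 1 - p := by linarith
  have hRq : 0 < R ^ (1 - p) := Real.rpow_pos_of_pos hR _
  -- `δ` is chosen so that the upper bound for the cap becomes half of the lower bound `c * a * ε ^
  -- m`.
  obtain ⟨ε₀, hε₀, hS⟩ := exists_surfaceAreaMeasure_le hL hk hu₀ hK.2 hWL hWu hc' hcK
    (δ := c * a / (2 * R ^ (1 - p))) (by positivity)
  set ε := min ε₀ 1 with hε
  have hεpos : 0 < ε := by positivity
  have hε1 : ε ≤ 1 := min_le_right _ _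
  set S : Set (subsphere L) := {u | ‖((u : Sphere n) : E n) - u₀‖ ≤ ε} with hSdef
  set η : Set (Sphere n) := {u | (u : E n) ∈ L ∧ u ≠ u₀ ∧ ‖(u : E n) - u₀‖ ≤ ε} with hη
  have hlow : ENNReal.ofReal (c * (a * ε ^ m)) ≤
      ((μHE[m] : Measure (subsphere L)).withDensity fun u => (φ u : ℝ≥0∞)) S := by
    rw [ENNReal.ofReal_mul (by positivity)]
    have hSm : MeasurableSet S := by
      exact (isClosed_le (f := fun u : subsphere L => ‖((u : Sphere n) : E n) - u₀‖) (by fun_prop)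
        continuous_const).measurableSet
    rw [withDensity_apply _ hSm]
    calc ENNReal.ofReal c * ENNReal.ofReal (a * ε ^ m) ≤ c * (μHE[m] : Measure (subsphere L)) S := by
          rw [ENNReal.ofReal_coe_nnreal]
          gcongr
          exact hcap ε hεpos hε1
      _ = ∫⁻ _ in S, c ∂(μHE[m] : Measure (subsphere L)) := by rw [setLIntegral_const]
      _ ≤ _ := lintegral_mono_ae (ae_restrict_of_ae (hae.mono fun u hu => hu.le))
  have hup : (lpSurfaceAreaMeasure p K).comap (Subtype.val : subsphere L → Sphere n) S ≤
      ENNReal.ofReal ((R * ε) ^ (1 - p)) * surfaceAreaMeasure K η := by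
    rw [(MeasurableEmbedding.subtype_coe (measurableSet_subsphere L)).comap_apply]
    have hsub : Subtype.val '' S ⊆ {u₀} ∪ η := by
      rintro _ ⟨u, hu, rfl⟩
      by_cases h : (u : Sphere n) = u₀
      · exact Or.inl h
      · exact Or.inr ⟨u.2, h, hu⟩
    refine (measure_mono hsub).trans ((measure_union_le _ _).trans ?_)
    -- The face with normal `u₀` may have positive area, but its weight `0 ^ (1 - p)` vanishes.
    have h1 : lpSurfaceAreaMeasure p K {u₀} = 0 := by
      rw [lpSurfaceAreaMeasure, withDensity_apply_eq_zero (measurable_lpWeight p K)]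
      convert measure_empty (μ := surfaceAreaMeasure K)
      refine eq_empty_of_forall_notMem ?_
      rintro u ⟨hu, rfl⟩
      refine hu ?_
      rw [h0, Real.zero_rpow hq.ne', ENNReal.ofReal_zero]
    have hηm : MeasurableSet η := by
      refine (measurableSet_subsphere L).inter ((measurableSet_singleton u₀).compl.inter ?_)
      exact (isClosed_le (f := fun u : Sphere n => ‖(u : E n) - u₀‖) (by fun_prop)
        continuous_const).measurableSet
    rw [h1, zero_add, lpSurfaceAreaMeasure, withDensity_apply _ hηm, ← setLIntegral_const]
    refine setLIntegral_mono measurable_const fun u hu => ENNReal.ofReal_le_ofReal ?_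
    refine Real.rpow_le_rpow (supportFunction_nonneg hK.2 _) (supportFunction_le fun x hx => ?_) hq.le
    have h2 : inner ℝ (u : E n) x = inner ℝ ((u : E n) - u₀) x + inner ℝ (u₀ : E n) x := by
      rw [inner_sub_left]; ring
    have h3 := inner_le_supportFunction hx (u₀ : E n)
    have h4 : inner ℝ ((u : E n) - u₀) x ≤ ε * R :=
      (real_inner_le_norm _ _).trans (mul_le_mul hu.2.2 (hRK x hx) (norm_nonneg _) hεpos.le)
    rw [h0] at h3
    rw [h2]
    linarith
  rw [hdens] at hup
  have h5 := hlow.trans (hup.trans (mul_le_mul_right (hS ε hεpos (min_le_left _ _)) _))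
  rw [← ENNReal.ofReal_mul (by positivity), ENNReal.ofReal_le_ofReal_iff (by positivity),
    Real.mul_rpow hR.le hεpos.le] at h5
  -- The exponent inequality `m ≤ 1 - p + k` is exactly `0 ≤ n - 2m - p`.
  have h6 : ε ^ (1 - p) * ε ^ k ≤ ε ^ m := by
    rw [← Real.rpow_natCast ε k, ← Real.rpow_natCast ε m, ← Real.rpow_add hεpos]
    refine Real.rpow_le_rpow_of_exponent_ge hεpos hε1 ?_
    rw [hnk] at hnmp
    push_cast at hnmp
    linarith
  have hεm : 0 < ε ^ m := by positivity
  have h7 : R ^ (1 - p) * ε ^ (1 - p) * (c * a / (2 * R ^ (1 - p)) * ε ^ k) =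
      c * a / 2 * (ε ^ (1 - p) * ε ^ k) := by field_simp
  rw [h7] at h5
  have h8 : c * a / 2 * (ε ^ (1 - p) * ε ^ k) ≤ c * a / 2 * ε ^ m := by gcongr
  have h9 : 0 < c * a * ε ^ m := by positivity
  linarith

end LpSurface

namespace LpSurface

open MeasureTheory Metric Set Filter Topology

/-! ### Local comparison of measures -/

section LocalComparison

variable {X : Type*} [TopologicalSpace X] [SecondCountableTopology X] [MeasurableSpace X]
  [BorelSpace X] {μ ν : Measure X}

/-- An inequality between measures can be checked locally, outside of a null set. -/
theorem measure_le_mul_of_locally {c : ℝ≥0∞} {N : Set X} (hN : μ N = 0)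
    (h : ∀ x ∉ N, ∃ U ∈ 𝓝 x, ∀ s ⊆ U, MeasurableSet s → μ s ≤ c * ν s) {s : Set X}
    (hs : MeasurableSet s) : μ s ≤ c * ν s := by
  choose! U hU hUs using h
  obtain ⟨t, htN, htc, ht⟩ := TopologicalSpace.countable_cover_nhdsWithin
    (f := fun x => interior (U x)) (s := Nᶜ)
    fun x hx => mem_nhdsWithin_of_mem_nhds (interior_mem_nhds.2 (hU x hx))
  rcases t.eq_empty_or_nonempty with rfl | htne
  · have : s ⊆ N := fun x _ => by
      by_contra hx
      simpa using ht hx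
    rw [measure_mono_null this hN]
    exact zero_le
  obtain ⟨g, rfl⟩ := htc.exists_eq_range htne
  set V : ℕ → Set X := disjointed fun j => interior (U (g j)) with hV
  have hVm : ∀ j, MeasurableSet (V j) :=
    MeasurableSet.disjointed fun j => isOpen_interior.measurableSet
  have hVU : ∀ j, V j ⊆ U (g j) := fun j => (disjointed_subset _ j).trans interior_subset
  have hcover : s ⊆ N ∪ ⋃ j, s ∩ V j := fun x hx => by
    by_cases hxN : x ∈ N
    · exact Or.inl hxN
    · refine Or.inr ?_
      rw [← inter_iUnion, hV, iUnion_disjointed]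
      exact ⟨hx, by simpa using ht hxN⟩
  calc μ s ≤ μ N + μ (⋃ j, s ∩ V j) := (measure_mono hcover).trans (measure_union_le _ _)
    _ ≤ ∑' j, μ (s ∩ V j) := by rw [hN, zero_add]; exact measure_iUnion_le _
    _ ≤ ∑' j, c * ν (s ∩ V j) := by
        gcongr with j
        exact hUs _ (htN ⟨j, rfl⟩) _ (inter_subset_right.trans (hVU j)) (hs.inter (hVm j))
    _ = c * ν (⋃ j, s ∩ V j) := by
        rw [ENNReal.tsum_mul_left, measure_iUnion _ fun j => hs.inter (hVm j)]
        exact fun i j hij => (disjoint_disjointed _ hij).mono inter_subset_right inter_subset_right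
    _ ≤ c * ν s := by
        gcongr
        exact iUnion_subset fun j => inter_subset_left

theorem ennreal_le_of_forall_le_mul {a b : ℝ≥0∞} (h : ∀ r : ℝ≥0, 1 < r → a ≤ r * b) : a ≤ b := by
  have hlim : Tendsto (fun r : ℝ≥0 => (r : ℝ≥0∞) * b) (𝓝[>] 1) (𝓝 (((1 : ℝ≥0) : ℝ≥0∞) * b)) := by
    refine ENNReal.Tendsto.mul_const ?_ (Or.inl (by simp))
    exact (ENNReal.continuous_coe.tendsto 1).mono_left nhdsWithin_le_nhds
  rw [ENNReal.coe_one, one_mul] at hlim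
  exact ge_of_tendsto hlim (eventually_mem_nhdsWithin.mono fun r hr => h r hr)

/-- A measure which is locally, up to factors close to one, a multiple `φ x` of another measure
`ν`, has density `φ` with respect to `ν`. -/
theorem eq_withDensity_of_locally {φ : X → ℝ≥0} (hφ : Continuous φ) (hφ0 : ∀ x, 0 < φ x)
    {N : Set X} (hμN : μ N = 0) (hνN : ν N = 0)
    (h : ∀ x ∉ N, ∀ r : ℝ≥0, 1 < r → ∃ U ∈ 𝓝 x, ∀ s ⊆ U, MeasurableSet s →
      μ s ≤ r * (φ x * ν s) ∧ φ x * ν s ≤ r * μ s) :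
    μ = ν.withDensity fun x => (φ x : ℝ≥0∞) := by
  set ρ := ν.withDensity fun x => (φ x : ℝ≥0∞) with hρ
  have hρN : ρ N = 0 := withDensity_absolutelyContinuous _ _ hνN
  -- One factor `r` comes from the hypothesis, the other from the oscillation of `φ` near `x`; the
  -- local bounds are later used with `√r`.
  have key : ∀ x ∉ N, ∀ r : ℝ≥0, 1 < r → ∃ U ∈ 𝓝 x, ∀ s ⊆ U, MeasurableSet s →
      μ s ≤ (r * r : ℝ≥0) * ρ s ∧ ρ s ≤ (r * r : ℝ≥0) * μ s := by
    intro x hx r hr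
    obtain ⟨U, hU, hUs⟩ := h x hx r hr
    have hr0 : 0 < r := one_pos.trans hr
    have hup : ∀ᶠ y in 𝓝 x, φ y < r * φ x :=
      hφ.continuousAt.eventually_lt_const (lt_mul_of_one_lt_left (hφ0 x) hr)
    have hlow : ∀ᶠ y in 𝓝 x, φ x < r * φ y :=
      (continuous_const.mul hφ).continuousAt.eventually_const_lt
        (lt_mul_of_one_lt_left (hφ0 x) hr)
    refine ⟨_, inter_mem hU (hup.and hlow), fun s hs hsm => ?_⟩
    obtain ⟨h1, h2⟩ := hUs s (hs.trans inter_subset_left) hsm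
    have h3 : φ x * ν s ≤ r * ρ s := by
      rw [hρ, withDensity_apply _ hsm, ← setLIntegral_const, ← lintegral_const_mul _ (by fun_prop)]
      refine setLIntegral_mono (by fun_prop) fun y hy => ?_
      exact_mod_cast (hs hy).2.2.le
    have h4 : ρ s ≤ r * (φ x * ν s) := by
      rw [hρ, withDensity_apply _ hsm, ← mul_assoc, ← setLIntegral_const]
      refine setLIntegral_mono (by fun_prop) fun y hy => ?_
      exact_mod_cast (hs hy).2.1.le
    push_cast
    refine ⟨h1.trans ?_, h4.trans ?_⟩
    · rw [mul_assoc]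
      gcongr
    · rw [mul_assoc]
      gcongr
  have hsqrt : ∀ r : ℝ≥0, 1 < r → 1 < NNReal.sqrt r ∧ NNReal.sqrt r * NNReal.sqrt r = r :=
    fun r hr => ⟨lt_of_mul_self_lt_mul_self₀ zero_le (by rwa [NNReal.mul_self_sqrt, one_mul]),
      NNReal.mul_self_sqrt r⟩
  ext s hs
  refine le_antisymm (ennreal_le_of_forall_le_mul fun r hr => ?_)
    (ennreal_le_of_forall_le_mul fun r hr => ?_)
  · refine measure_le_mul_of_locally hμN (fun x hx => ?_) hs
    obtain ⟨U, hU, hUs⟩ := key x hx _ (hsqrt r hr).1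
    rw [(hsqrt r hr).2] at hUs
    exact ⟨U, hU, fun s hs hsm => (hUs s hs hsm).1⟩
  · refine measure_le_mul_of_locally hρN (fun x hx => ?_) hs
    obtain ⟨U, hU, hUs⟩ := key x hx _ (hsqrt r hr).1
    rw [(hsqrt r hr).2] at hUs
    exact ⟨U, hU, fun s hs hsm => (hUs s hs hsm).2⟩

end LocalComparison

end LpSurface

namespace LpSurface

open MeasureTheory Metric Set Filter Topology

/-! ### A convex body with a degenerate normal at the origin -/

/-- A sharpening of the weighted inequality between arithmetic and geometric means. -/
theorem weighted_mean_sub_le {a b q : ℝ} (ha : 0 < a) (hb : 0 ≤ b) (hq : 1 / 2 ≤ q) :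
    (1 - q) * a + q * b - a ^ (1 - q) * b ^ q ≤ q * (√a - √b) ^ 2 := by
  have hq0 : 0 < q := by linarith
  -- The weights are such that the geometric mean of `a` and `a ^ (1 - q) * b ^ q` is `√a * √b`; the
  -- first is nonnegative because `q ≥ 1/2`.
  have h := Real.geom_mean_le_arith_mean2_weighted (w₁ := (2 * q - 1) / (2 * q)) (w₂ := 1 / (2 * q))
    (p₁ := a) (p₂ := a ^ (1 - q) * b ^ q) (div_nonneg (by linarith) (by linarith)) (by positivity)
    ha.le (by positivity) (by field_simp; ring)
  have h1 : a ^ ((2 * q - 1) / (2 * q)) * (a ^ (1 - q) * b ^ q) ^ (1 / (2 * q)) = √a * √b := by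
    rw [Real.mul_rpow (by positivity) (by positivity), ← Real.rpow_mul ha.le, ← Real.rpow_mul hb,
      ← mul_assoc, ← Real.rpow_add ha, Real.sqrt_eq_rpow, Real.sqrt_eq_rpow]
    congr 2
    · field_simp
      ring
    · field_simp
  rw [h1] at h
  have h2 : 2 * q * (√a * √b) ≤ (2 * q - 1) * a + a ^ (1 - q) * b ^ q := by
    calc 2 * q * (√a * √b) ≤ 2 * q * ((2 * q - 1) / (2 * q) * a
          + 1 / (2 * q) * (a ^ (1 - q) * b ^ q)) := by gcongr
      _ = _ := by field_simp
  have h3 : (√a - √b) ^ 2 = a + b - 2 * (√a * √b) := by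
    nlinarith [Real.sq_sqrt ha.le, Real.sq_sqrt hb]
  rw [h3]
  linarith

variable {n : ℕ}

/-- The parametrization by its normals of the hypersurface with support function
`u ↦ (1 + ⟪e, u⟫) ^ q`. -/
noncomputable def profile (e : E n) (q : ℝ) (u : E n) : E n :=
  (1 + inner ℝ e u) ^ (q - 1) • (((1 - q) * (1 + inner ℝ e u) + q) • u + q • e)

section Profile

variable {e u v : E n} {q : ℝ}

theorem one_add_inner_nonneg (he : ‖e‖ = 1) (hu : ‖u‖ = 1) : 0 ≤ 1 + inner ℝ e u := by
  have := neg_le_of_abs_le (abs_real_inner_le_norm e u)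
  rw [he, hu, mul_one] at this
  linarith

theorem rpow_sub_one_mul {w q : ℝ} (hw : 0 < w) : w ^ (q - 1) * w = w ^ q := by
  rw [Real.rpow_sub_one hw.ne']
  field_simp

theorem inner_profile_self (hu : ‖u‖ = 1) (hw : 0 < 1 + inner ℝ e u) :
    inner ℝ u (profile e q u) = (1 + inner ℝ e u) ^ q := by
  rw [profile, inner_smul_right, inner_add_right, inner_smul_right, inner_smul_right,
    real_inner_self_eq_norm_sq, hu, real_inner_comm e u, ← rpow_sub_one_mul (q := q) hw]
  ring

/-- This is the fibre radius of `coneBody`. For `1/2 < q ≤ 1` the second factor is at least `2 * q -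
1 > 0`, so the radius decays exactly like `w ^ q` at `w = 0`. -/
theorem inner_axis_profile (he : ‖e‖ = 1) (hw : 0 < 1 + inner ℝ e u) :
    inner ℝ e (profile e q u) =
      (1 + inner ℝ e u) ^ q * ((1 - q) * (1 + inner ℝ e u) + (2 * q - 1)) := by
  rw [profile, inner_smul_right, inner_add_right, inner_smul_right, inner_smul_right,
    real_inner_self_eq_norm_sq, he, ← rpow_sub_one_mul (q := q) hw]
  ring

theorem profile_mem {L : Submodule ℝ (E n)} (he : e ∈ L) (hu : u ∈ L) : profile e q u ∈ L :=
  L.smul_mem _ (L.add_mem (L.smul_mem _ hu) (L.smul_mem _ he))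

/-- The points of the hypersurface satisfy the supporting inequalities, strictly except at the
normal itself. -/
theorem inner_profile_add_le (he : ‖e‖ = 1) (hu : ‖u‖ = 1) (hv : ‖v‖ = 1)
    (hw : 0 < 1 + inner ℝ e u) (hq : 1 / 2 ≤ q) :
    inner ℝ v (profile e q u) + (1 - q) * (1 + inner ℝ e u) ^ q * (1 - inner ℝ v u) ≤
      (1 + inner ℝ e v) ^ q := by
  set w := 1 + inner ℝ e u with hwdef
  set w' := 1 + inner ℝ e v with hwdef'
  have hw' : 0 ≤ w' := one_add_inner_nonneg he hv
  set c := inner ℝ v u with hc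
  -- The half-angle formula makes `√(1 + ⟪e, x⟫)` Lipschitz with constant `1 / √2` on the sphere,
  -- whence `(√w - √w')² ≤ 1 - ⟪v, u⟫`.
  have hsq : ∀ x : E n, ‖x‖ = 1 → √(1 + inner ℝ e x) = ‖x + e‖ / √2 := by
    intro x hx
    have h1 : 1 + inner ℝ e x = ‖x + e‖ ^ 2 / 2 := by
      rw [@norm_add_sq_real, hx, he, real_inner_comm]
      ring
    rw [h1, Real.sqrt_div (by positivity), Real.sqrt_sq (norm_nonneg _)]
  have h1 : (√w - √w') ^ 2 ≤ 1 - c := by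
    rw [hsq u hu, hsq v hv, ← sub_div, div_pow, Real.sq_sqrt zero_le_two]
    have h2 : |‖u + e‖ - ‖v + e‖| ≤ ‖u - v‖ := by
      refine (abs_norm_sub_norm_le _ _).trans (le_of_eq ?_)
      congr 1
      abel
    have h3 : ‖u - v‖ ^ 2 = 2 * (1 - c) := by
      rw [@norm_sub_sq_real, hu, hv, real_inner_comm]
      ring
    have h4 := pow_le_pow_left₀ (abs_nonneg _) h2 2
    rw [sq_abs, h3] at h4
    linarith
  have h2 := weighted_mean_sub_le hw hw' hq
  have hexp : inner ℝ v (profile e q u) = w ^ (q - 1) * (((1 - q) * w + q) * c + q * (w' - 1)) := by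
    rw [profile, inner_smul_right, inner_add_right, inner_smul_right, inner_smul_right,
      real_inner_comm e v]
    simp only [hwdef', hwdef, hc]
    ring
  have hone : w ^ (q - 1) * w ^ (1 - q) = 1 := by
    rw [← Real.rpow_add hw]
    simp
  have hpos : 0 < w ^ (q - 1) := Real.rpow_pos_of_pos hw _
  have h3 : ((1 - q) * w + q) * c + q * (w' - 1) + (1 - q) * w * (1 - c) ≤ w ^ (1 - q) * w' ^ q := by
    nlinarith [mul_le_mul_of_nonneg_left h1 (by linarith : 0 ≤ q)]
  have h4 := mul_le_mul_of_nonneg_left h3 hpos.le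
  rw [← mul_assoc, hone, one_mul] at h4
  rw [hexp, ← rpow_sub_one_mul (q := q) hw]
  linarith

end Profile

/-- The convex body whose projection to `L` has support function `u ↦ (1 + ⟪e, u⟫) ^ q`, and whose
fibre over a point `z` of this projection is a ball of radius `⟪e, z⟫`. -/
noncomputable def coneBody (L : Submodule ℝ (E n)) (e : E n) (he : ‖e‖ = 1) (heL : e ∈ L) (q : ℝ)
    (hq : 0 ≤ q) : ConvexBody (E n) where
  carrier := {x | (∀ u : Sphere n, (u : E n) ∈ L → inner ℝ (u : E n) x ≤ (1 + inner ℝ e (u : E n)) ^ q) ∧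
    ‖Lᗮ.starProjection x‖ ≤ inner ℝ e x}
  convex' := by
    intro x hx y hy s t hs ht hst
    refine ⟨fun u hu => ?_, ?_⟩
    · rw [inner_add_right, inner_smul_right, inner_smul_right]
      have : (1 + inner ℝ e (u : E n)) ^ q =
          s * (1 + inner ℝ e (u : E n)) ^ q + t * (1 + inner ℝ e (u : E n)) ^ q := by
        rw [← add_mul, hst, one_mul]
      rw [this]
      gcongr
      · exact hx.1 u hu
      · exact hy.1 u hu
    · rw [inner_add_right, inner_smul_right, inner_smul_right, map_add, map_smul, map_smul]
      refine (norm_add_le _ _).trans ?_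
      rw [norm_smul, norm_smul, Real.norm_of_nonneg hs, Real.norm_of_nonneg ht]
      gcongr
      · exact hx.2
      · exact hy.2
  isCompact' := by
    refine isCompact_of_isClosed_isBounded ?_ ?_
    · refine IsClosed.and ?_ (isClosed_le (by fun_prop) (by fun_prop))
      have : {x : E n | ∀ u : Sphere n, (u : E n) ∈ L →
          inner ℝ (u : E n) x ≤ (1 + inner ℝ e (u : E n)) ^ q} = ⋂ u : Sphere n, ⋂ _ : (u : E n) ∈ L,
          {x | inner ℝ (u : E n) x ≤ (1 + inner ℝ e (u : E n)) ^ q} := by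
        ext x
        simp
      rw [this]
      exact isClosed_biInter fun u _ => isClosed_le (by fun_prop) continuous_const
    · have hB : ∀ u : E n, ‖u‖ = 1 → (1 + inner ℝ e u) ^ q ≤ 2 ^ q := fun u hu => by
        refine Real.rpow_le_rpow (one_add_inner_nonneg he hu) ?_ hq
        have := real_inner_le_norm e u
        rw [he, hu] at this
        linarith
      refine isBounded_iff_forall_norm_le.2 ⟨2 ^ q + 2 ^ q, fun x hx => ?_⟩
      have h1 : ‖L.starProjection x‖ ≤ 2 ^ q := by
        rcases eq_or_ne (L.starProjection x) 0 with h0 | h0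
        · rw [h0, norm_zero]
          positivity
        · have hn := norm_ne_zero_iff.2 h0
          have hu : ‖‖L.starProjection x‖⁻¹ • L.starProjection x‖ = 1 := by
            rw [norm_smul, norm_inv, norm_norm, inv_mul_cancel₀ hn]
          have h2 := hx.1 ⟨‖L.starProjection x‖⁻¹ • L.starProjection x, by simpa using hu⟩
            (L.smul_mem _ (L.starProjection_apply_mem x))
          have h3 : inner ℝ (L.starProjection x) x = ‖L.starProjection x‖ ^ 2 := by
            have h4 : inner ℝ (L.starProjection x) (x - L.starProjection x) = 0 :=
              Submodule.inner_right_of_mem_orthogonal (L.starProjection_apply_mem x)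
                (L.sub_starProjection_mem_orthogonal x)
            rw [inner_sub_right, real_inner_self_eq_norm_sq] at h4
            linarith
          have h5 : inner ℝ (‖L.starProjection x‖⁻¹ • L.starProjection x) x = ‖L.starProjection x‖ := by
            rw [real_inner_smul_left, h3]
            field_simp
          exact h5.symm.le.trans (h2.trans (hB _ hu))
      have h2 : ‖Lᗮ.starProjection x‖ ≤ 2 ^ q :=
        hx.2.trans ((hx.1 ⟨e, by simpa using he⟩ heL).trans (hB e he))
      have h3 : x = L.starProjection x + Lᗮ.starProjection x := by simp
      calc ‖x‖ = ‖L.starProjection x + Lᗮ.starProjection x‖ := by rw [← h3]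
        _ ≤ _ := norm_add_le _ _
        _ ≤ _ := add_le_add h1 h2
  nonempty' := by
    refine ⟨0, fun u _ => ?_, by simp⟩
    rw [inner_zero_right]
    exact Real.rpow_nonneg (one_add_inner_nonneg he (norm_eq_of_mem_sphere u)) _

section ConeBody

variable {L : Submodule ℝ (E n)} {e : E n} {he : ‖e‖ = 1} {heL : e ∈ L} {q : ℝ} {hq : 0 ≤ q}
  {x : E n} {u : Sphere n}

theorem mem_coneBody : x ∈ coneBody L e he heL q hq ↔
    (∀ u : Sphere n, (u : E n) ∈ L → inner ℝ (u : E n) x ≤ (1 + inner ℝ e (u : E n)) ^ q) ∧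
      ‖Lᗮ.starProjection x‖ ≤ inner ℝ e x := Iff.rfl

/-- The ball of radius `1/4` about `e / 2` is contained in the body: `w ^ q ≥ w` for `w ≤ 1` and `w
^ q ≥ 1` for `w ≥ 1` dominate `(w - 1) / 2 + 1 / 4`. -/
theorem isBodyWithOrigin_coneBody (hq1 : q ≤ 1) : IsBodyWithOrigin (coneBody L e he heL q hq) := by
  constructor
  · refine ⟨(1 / 2 : ℝ) • e, mem_interior_iff_mem_nhds.2 (Metric.mem_nhds_iff.2
      ⟨1 / 4, by norm_num, fun x hx => ?_⟩)⟩
    rw [mem_ball, dist_eq_norm] at hx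
    obtain ⟨d, rfl⟩ : ∃ d, x = (1 / 2 : ℝ) • e + d := ⟨x - (1 / 2 : ℝ) • e, by abel⟩
    rw [add_sub_cancel_left] at hx
    refine mem_coneBody.2 ⟨fun u hu => ?_, ?_⟩
    · rw [inner_add_right, inner_smul_right, real_inner_comm]
      have hun := norm_eq_of_mem_sphere u
      have h1 := real_inner_le_norm (u : E n) d
      rw [hun, one_mul] at h1
      have hw := one_add_inner_nonneg he hun
      set w := 1 + inner ℝ e (u : E n) with hwdef
      have hw2 : w ≤ 2 := by
        have := real_inner_le_norm e (u : E n)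
        rw [he, hun] at this
        linarith
      have hwe : inner ℝ e (u : E n) = w - 1 := by rw [hwdef]; ring
      rw [hwe]
      rcases le_total w 1 with h | h
      · have := Real.rpow_le_rpow_of_exponent_ge_of_imp hw h hq1 (by
          intro h0 hq0; norm_num at hq0)
        rw [Real.rpow_one] at this
        linarith
      · have := Real.one_le_rpow h hq
        linarith
    · have h0 : Lᗮ.starProjection e = 0 := Lᗮ.starProjection_apply_eq_zero_iff.2 (L.le_orthogonal_orthogonal heL)
      rw [map_add, map_smul, h0, smul_zero, zero_add, inner_add_right, inner_smul_right,
        real_inner_self_eq_norm_sq, he]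
      have h1 : ‖Lᗮ.starProjection d‖ ≤ ‖d‖ := Submodule.norm_starProjection_apply_le _ _
      have h2 := neg_le_of_abs_le (abs_real_inner_le_norm e d)
      rw [he, one_mul] at h2
      linarith
  · refine mem_coneBody.2 ⟨fun u _ => ?_, by simp⟩
    rw [inner_zero_right]
    exact Real.rpow_nonneg (one_add_inner_nonneg he (norm_eq_of_mem_sphere u)) _

theorem starProjection_orthogonal_add {L : Submodule ℝ (E n)} {z y : E n} (hz : z ∈ L)
    (hy : y ∈ Lᗮ) : Lᗮ.starProjection (z + y) = y := by
  rw [map_add, Submodule.starProjection_eq_self_iff.2 hy,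
    Lᗮ.starProjection_apply_eq_zero_iff.2 (L.le_orthogonal_orthogonal hz), zero_add]

theorem profile_add_mem_coneBody (hq2 : 1 / 2 ≤ q) (hq1 : q ≤ 1) (huL : (u : E n) ∈ L)
    (hw : 0 < 1 + inner ℝ e (u : E n)) {y : E n} (hy : y ∈ Lᗮ)
    (hyt : ‖y‖ ≤ inner ℝ e (profile e q u)) : profile e q u + y ∈ coneBody L e he heL q hq := by
  refine mem_coneBody.2 ⟨fun v hv => ?_, ?_⟩
  · rw [inner_add_right, Submodule.inner_right_of_mem_orthogonal hv hy, add_zero]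
    have hun := norm_eq_of_mem_sphere u
    have hvn := norm_eq_of_mem_sphere v
    refine le_trans (le_add_of_nonneg_right ?_) (inner_profile_add_le he hun hvn hw hq2)
    have h1 := real_inner_le_norm (v : E n) u
    rw [hun, hvn, one_mul] at h1
    exact mul_nonneg (mul_nonneg (by linarith) (by positivity)) (by linarith)
  · rw [starProjection_orthogonal_add (profile_mem heL huL) hy, inner_add_right,
      Submodule.inner_right_of_mem_orthogonal heL hy, add_zero]
    exact hyt

theorem inner_axis_profile_pos (he : ‖e‖ = 1) (hq2 : 1 / 2 < q) (hq1 : q ≤ 1) {u : E n}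
    (hw : 0 < 1 + inner ℝ e u) : 0 < inner ℝ e (profile e q u) := by
  rw [inner_axis_profile he hw]
  exact mul_pos (Real.rpow_pos_of_pos hw _)
    (add_pos_of_nonneg_of_pos (mul_nonneg (by linarith) hw.le) (by linarith))

/-- The bound is attained at `profile e q u`; in the remaining case `u = -e` both sides vanish,
since the origin belongs to the body. -/
theorem supportFunction_coneBody (hq2 : 1 / 2 < q) (hq1 : q ≤ 1) (huL : (u : E n) ∈ L) :
    supportFunction (coneBody L e he heL q hq) u = (1 + inner ℝ e (u : E n)) ^ q := by
  refine le_antisymm (supportFunction_le fun x hx => (mem_coneBody.1 hx).1 u huL) ?_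
  have hun := norm_eq_of_mem_sphere u
  rcases (one_add_inner_nonneg he hun).eq_or_lt with hw | hw
  · rw [← hw, Real.zero_rpow (by linarith)]
    exact supportFunction_nonneg (isBodyWithOrigin_coneBody hq1).2 _
  · rw [← inner_profile_self hun hw]
    refine inner_le_supportFunction ?_ _
    have := profile_add_mem_coneBody (he := he) (heL := heL) (hq := hq) hq2.le hq1 huL hw
      (zero_mem _) (by rw [norm_zero]; exact (inner_axis_profile_pos he hq2 hq1 hw).le)
    rwa [add_zero] at this

/-- The projection to `L` of a point with normal `u ∈ L` is `profile e q u`. -/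
theorem sub_profile_mem_orthogonal (hx : x ∈ coneBody L e he heL q hq) (huL : (u : E n) ∈ L)
    (hw : 0 < 1 + inner ℝ e (u : E n))
    (hxu : inner ℝ (u : E n) x = (1 + inner ℝ e (u : E n)) ^ q) : x - profile e q u ∈ Lᗮ := by
  have hun := norm_eq_of_mem_sphere u
  rw [Submodule.mem_orthogonal]
  intro v hv
  -- On `L`, the 1-homogeneous extension `‖·‖ (1 + ⟪e, ·⟫ / ‖·‖) ^ q` dominates `⟪·, x⟫` with
  -- equality at `u`. Equating derivatives along `v` determines `⟪v, x⟫`.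
  set N : ℝ → ℝ := fun s => ‖(u : E n) + s • v‖ with hN
  have hline : HasDerivAt (fun s : ℝ => (u : E n) + s • v) v 0 := by
    simpa using ((hasDerivAt_id (0 : ℝ)).smul_const v).const_add (u : E n)
  have hN0 : N 0 = 1 := by simp [hN, hun]
  have hNd : HasDerivAt N (inner ℝ (u : E n) v) 0 := by
    have h1 := hline.norm_sq
    have h2 := h1.sqrt (by simp [hun])
    convert! h2 using 1
    · ext s
      rw [Real.sqrt_sq (norm_nonneg _)]
    · simp [hun]
  set w := 1 + inner ℝ e (u : E n) with hwdef
  have hlin : HasDerivAt (fun s : ℝ => inner ℝ e ((u : E n) + s • v)) (inner ℝ e v) 0 := by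
    simpa using (hasDerivAt_const (0 : ℝ) e).inner ℝ hline
  have hlinx : HasDerivAt (fun s : ℝ => inner ℝ ((u : E n) + s • v) x) (inner ℝ v x) 0 := by
    simpa using hline.inner ℝ (hasDerivAt_const (0 : ℝ) x)
  have hG : HasDerivAt (fun s => 1 + inner ℝ e ((u : E n) + s • v) / N s)
      (inner ℝ e v - inner ℝ e (u : E n) * inner ℝ (u : E n) v) 0 := by
    have := (hlin.div hNd (by rw [hN0]; exact one_ne_zero)).const_add 1
    simpa [hN0] using this
  have hF := (hNd.mul (hG.rpow_const (p := q) (Or.inl (by simp [hN0]; exact hw.ne')))).sub hlinx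
  have hmin : IsLocalMin (fun s => N s * (1 + inner ℝ e ((u : E n) + s • v) / N s) ^ q
      - inner ℝ ((u : E n) + s • v) x) 0 := by
    have hpos : ∀ᶠ s in 𝓝 (0 : ℝ), 0 < N s :=
      hNd.continuousAt.eventually_const_lt (by rw [hN0]; exact one_pos)
    filter_upwards [hpos] with s hs
    have h0 : N 0 * (1 + inner ℝ e ((u : E n) + (0 : ℝ) • v) / N 0) ^ q
        - inner ℝ ((u : E n) + (0 : ℝ) • v) x = 0 := by
      rw [hN0, zero_smul, add_zero, hxu, div_one, one_mul, sub_self]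
    rw [h0]
    have h1 := (mem_coneBody.1 hx).1
      ⟨(N s)⁻¹ • ((u : E n) + s • v), by
        rw [mem_sphere_zero_iff_norm, norm_smul, norm_inv, Real.norm_of_nonneg hs.le]
        exact inv_mul_cancel₀ hs.ne'⟩
      (L.smul_mem _ (L.add_mem huL (L.smul_mem _ hv)))
    simp only [inner_smul_right, real_inner_smul_left] at h1
    rw [inv_mul_le_iff₀ hs, inv_mul_eq_div] at h1
    linarith
  have h0 := hmin.hasDerivAt_eq_zero hF
  simp only [hN0, zero_smul, add_zero, div_one] at h0
  rw [inner_sub_right, profile, inner_smul_right, inner_add_right, inner_smul_right,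
    inner_smul_right, real_inner_comm (u : E n) v, real_inner_comm e v]
  have h1 := rpow_sub_one_mul (q := q) hw
  rw [← hwdef] at h0 ⊢
  have h2 : inner ℝ e (u : E n) = w - 1 := by rw [hwdef]; ring
  rw [h2] at h0
  linear_combination -h0 - (inner ℝ (u : E n) v) * h1

end ConeBody

end LpSurface

/-! ### Normals and regular boundary points of `coneBody` -/

namespace LpSurface

open MeasureTheory Metric Set Filter Topology

variable {n : ℕ} {L : Submodule ℝ (E n)} {e : E n} {he : ‖e‖ = 1} {heL : e ∈ L} {q : ℝ} {hq : 0 ≤ q}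
  {x : E n} {u : Sphere n}

theorem inner_eq_of_sub_mem_orthogonal {L : Submodule ℝ (E n)} {a b l : E n} (h : a - b ∈ Lᗮ)
    (hl : l ∈ L) : inner ℝ l a = inner ℝ l b := by
  have := Submodule.inner_right_of_mem_orthogonal hl h
  rwa [inner_sub_right, sub_eq_zero] at this

/-- At the points of `coneBody` on the boundary of the cone there is a normal outside of `L`. -/
theorem exists_isExteriorNormal_notMem (hx0 : Lᗮ.starProjection x ≠ 0) (hxe : ‖Lᗮ.starProjection x‖ = inner ℝ e x) :
    ∃ v : Sphere n, IsExteriorNormal (coneBody L e he heL q hq) x v ∧ (v : E n) ∉ L ∧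
      inner ℝ (v : E n) x = 0 := by
  set y := Lᗮ.starProjection x with hy
  have hyL : y ∈ Lᗮ := Lᗮ.starProjection_apply_mem x
  have hyn : 0 < ‖y‖ := norm_pos_iff.2 hx0
  -- The gradient at `x` of the cone constraint `‖Lᗮ.starProjection x‖ - ⟪e, x⟫ ≤ 0`.
  set a : E n := ‖y‖⁻¹ • y - e with ha
  have hay : Lᗮ.starProjection a = ‖y‖⁻¹ • y := by
    have : a = -e + ‖y‖⁻¹ • y := by rw [ha]; abel
    rw [this]
    exact starProjection_orthogonal_add (L.neg_mem heL) (Lᗮ.smul_mem _ hyL)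
  have haL : a ∉ L := fun h => by
    have := Lᗮ.starProjection_apply_eq_zero_iff.2 (L.le_orthogonal_orthogonal h)
    rw [hay, smul_eq_zero] at this
    rcases this with h | h
    · exact hyn.ne' (inv_eq_zero.1 h)
    · exact hx0 h
  have ha0 : a ≠ 0 := fun h => haL (h ▸ L.zero_mem)
  have han : 0 < ‖a‖ := norm_pos_iff.2 ha0
  have hinner : ∀ z : E n, inner ℝ a z = ‖y‖⁻¹ * inner ℝ y (Lᗮ.starProjection z) - inner ℝ e z := by
    intro z
    have h1 : inner ℝ y (z - Lᗮ.starProjection z) = 0 :=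
      Submodule.inner_right_of_mem_orthogonal hyL (Lᗮ.sub_starProjection_mem_orthogonal z)
    rw [inner_sub_right, sub_eq_zero] at h1
    rw [ha, inner_sub_left, real_inner_smul_left, h1]
  have hax : inner ℝ a x = 0 := by
    rw [hinner, ← hy, real_inner_self_eq_norm_sq, ← hxe]
    field_simp
    ring
  refine ⟨⟨‖a‖⁻¹ • a, by simp [norm_smul, han.ne']⟩, fun z hz => ?_, fun h => haL ?_, ?_⟩
  · rw [real_inner_smul_left, inner_sub_right, hax, sub_zero]
    refine mul_nonpos_of_nonneg_of_nonpos (by positivity) ?_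
    rw [hinner]
    have h1 := real_inner_le_norm y (Lᗮ.starProjection z)
    have h2 : ‖y‖⁻¹ * inner ℝ y (Lᗮ.starProjection z) ≤ ‖Lᗮ.starProjection z‖ := by
      rw [inv_mul_le_iff₀ hyn]
      exact h1
    linarith [(mem_coneBody.1 hz).2]
  · have := L.smul_mem ‖a‖ h
    rwa [smul_smul, mul_inv_cancel₀ han.ne', one_smul] at this
  · rw [real_inner_smul_left, hax, mul_zero]

/-- All normals at points in the interior of the cone lie in `L`. -/
theorem mem_of_isExteriorNormal (hx : x ∈ coneBody L e he heL q hq)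
    (hxe : ‖Lᗮ.starProjection x‖ < inner ℝ e x)
    (hu : IsExteriorNormal (coneBody L e he heL q hq) x u) : (u : E n) ∈ L := by
  have key : Lᗮ.starProjection (u : E n) = 0 := by
    by_contra hne
    set v := Lᗮ.starProjection (u : E n) with hv
    have hvL : v ∈ Lᗮ := Lᗮ.starProjection_apply_mem _
    have hvn : 0 < ‖v‖ := norm_pos_iff.2 hne
    -- The slack in the cone constraint allows a move of this size along the `Lᗮ`-component of `u`,
    -- which a normal `u` forbids unless that component is zero.
    set s := (inner ℝ e x - ‖Lᗮ.starProjection x‖) / ‖v‖ with hs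
    have hs0 : 0 < s := div_pos (by linarith) hvn
    have hmem : x + s • v ∈ coneBody L e he heL q hq := by
      have hx' := mem_coneBody.1 hx
      refine mem_coneBody.2 ⟨fun w hw => ?_, ?_⟩
      · rw [inner_add_right, Submodule.inner_right_of_mem_orthogonal hw (Lᗮ.smul_mem _ hvL), add_zero]
        exact hx'.1 w hw
      · rw [inner_add_right, Submodule.inner_right_of_mem_orthogonal heL (Lᗮ.smul_mem _ hvL), add_zero,
          map_add, Submodule.starProjection_eq_self_iff.2 (Lᗮ.smul_mem s hvL)]
        refine (norm_add_le _ _).trans (le_of_eq ?_)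
        rw [norm_smul, Real.norm_of_nonneg hs0.le, hs]
        field_simp
        ring
    have h1 := hu _ hmem
    have h2 : inner ℝ v ((u : E n) - v) = 0 :=
      Submodule.inner_right_of_mem_orthogonal hvL (Lᗮ.sub_starProjection_mem_orthogonal _)
    rw [inner_sub_right, real_inner_self_eq_norm_sq] at h2
    rw [add_sub_cancel_left, inner_smul_right, real_inner_comm] at h1
    have h3 : 0 < s * ‖v‖ ^ 2 := by positivity
    have h4 : inner ℝ v (u : E n) = ‖v‖ ^ 2 := by linarith
    rw [h4] at h1
    linarith
  have := Lᗮ.starProjection_apply_eq_zero_iff.1 key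
  rwa [L.orthogonal_orthogonal] at this

/-- The support function vanishes at the normals of regular boundary points outside of `L`. -/
theorem supportFunction_gaussMap_eq_zero (x : regularBoundary (coneBody L e he heL q hq))
    (hxL : (gaussMap _ x : E n) ∉ L) :
    supportFunction (coneBody L e he heL q hq) (gaussMap _ x : E n) = 0 := by
  have hxK : (x : E n) ∈ coneBody L e he heL q hq := frontier_subset _ x.2.1
  have hle := (mem_coneBody.1 hxK).2
  have heq : ‖Lᗮ.starProjection (x : E n)‖ = inner ℝ e (x : E n) := by
    refine le_antisymm hle (not_lt.1 fun hlt => hxL ?_)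
    exact mem_of_isExteriorNormal hxK hlt (gaussMap_isExteriorNormal _ x)
  -- If the fibre is a point, `-e ∈ L` is a normal, contradicting `hxL`. Otherwise the unique normal
  -- is that of the cone, whose supporting hyperplane passes through the origin.
  by_cases hx0 : Lᗮ.starProjection (x : E n) = 0
  · rw [hx0, norm_zero] at heq
    let v : Sphere n := ⟨-e, by simpa using he⟩
    have hv : IsExteriorNormal (coneBody L e he heL q hq) (x : E n) v := fun z hz => by
      have h1 := (norm_nonneg _).trans (mem_coneBody.1 hz).2
      change inner ℝ (-e) (z - (x : E n)) ≤ 0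
      rw [inner_neg_left, inner_sub_right, ← heq]
      linarith
    rw [(gaussMap_eq_iff _ x v).2 hv] at hxL
    exact absurd (L.neg_mem heL) hxL
  · obtain ⟨v, hv, -, hvx⟩ := exists_isExteriorNormal_notMem (he := he) (heL := heL) (hq := hq) hx0 heq
    rw [← (gaussMap_eq_iff _ x v).2 hv, inner_gaussMap] at hvx
    exact hvx

/-- The points of the regular boundary with normals in a subset of `L`. -/
theorem image_gaussMap_preimage_coneBody (hq2 : 1 / 2 < q) (hq1 : q < 1) {η : Set (Sphere n)}
    (hη : ∀ u ∈ η, (u : E n) ∈ L ∧ 0 < 1 + inner ℝ e (u : E n)) :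
    {x : E n | ∃ hx : x ∈ regularBoundary (coneBody L e he heL q hq), gaussMap _ ⟨x, hx⟩ ∈ η} =
      (fun i : Sphere n × Lᗮ => profile e q i.1 + i.2) ''
        {i | i.1 ∈ η ∧ ‖i.2‖ < inner ℝ e (profile e q i.1)} := by
  ext x
  constructor
  · rintro ⟨hx, hxη⟩
    obtain ⟨huL, hw⟩ := hη _ hxη
    have hun := gaussMap_isExteriorNormal _ ⟨x, hx⟩
    set u := gaussMap _ ⟨x, hx⟩ with hu
    have hxK : x ∈ coneBody L e he heL q hq := frontier_subset _ hx.1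
    have h1 := (isExteriorNormal_iff hxK u).1 hun
    rw [supportFunction_coneBody hq2 hq1.le huL] at h1
    have h2 := sub_profile_mem_orthogonal hxK huL hw h1
    have hxe : inner ℝ e x = inner ℝ e (profile e q u) := inner_eq_of_sub_mem_orthogonal h2 heL
    have hxp : Lᗮ.starProjection x = x - profile e q u := by
      have := starProjection_orthogonal_add (profile_mem (q := q) heL huL) h2
      rwa [add_sub_cancel] at this
    refine ⟨(u, ⟨x - profile e q u, h2⟩), ⟨hxη, ?_⟩, by simp⟩
    change ‖x - profile e q u‖ < inner ℝ e (profile e q u)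
    have hle := (mem_coneBody.1 hxK).2
    rw [hxp, hxe] at hle
    refine lt_of_le_of_ne hle fun heq => ?_
    have hpos := inner_axis_profile_pos he hq2 hq1.le hw
    obtain ⟨v, hv, hvL, -⟩ := exists_isExteriorNormal_notMem
      (he := he) (heL := heL) (hq := hq) (by rw [hxp, ← norm_pos_iff, heq]; exact hpos) (by rw [hxp, hxe, heq])
    rw [← (gaussMap_eq_iff _ ⟨x, hx⟩ v).2 hv] at hvL
    exact hvL huL
  · rintro ⟨⟨u, y⟩, ⟨huη, hy⟩, rfl⟩
    obtain ⟨huL, hw⟩ := hη _ huη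
    have hun := norm_eq_of_mem_sphere u
    have hxK : profile e q u + y ∈ coneBody L e he heL q hq :=
      profile_add_mem_coneBody hq2.le hq1.le huL hw y.2 hy.le
    have hinner : ∀ v ∈ L, inner ℝ v (profile e q u + y) = inner ℝ v (profile e q u) := fun v hv => by
      rw [inner_add_right, Submodule.inner_right_of_mem_orthogonal hv y.2, add_zero]
    have hnormal : IsExteriorNormal (coneBody L e he heL q hq) (profile e q u + y) u := by
      rw [isExteriorNormal_iff hxK, supportFunction_coneBody hq2 hq1.le huL, hinner _ huL,
        inner_profile_self hun hw]
    have hreg : profile e q u + y ∈ regularBoundary (coneBody L e he heL q hq) := by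
      refine ⟨mem_frontier_of_isExteriorNormal hxK hnormal, u, hnormal, fun v hv => ?_⟩
      have hvn := norm_eq_of_mem_sphere v
      have hvL : (v : E n) ∈ L := by
        refine mem_of_isExteriorNormal hxK ?_ hv
        rw [starProjection_orthogonal_add (profile_mem heL huL) y.2, hinner _ heL]
        exact hy
      replace hv := (isExteriorNormal_iff hxK v).1 hv
      rw [supportFunction_coneBody hq2 hq1.le hvL, hinner _ hvL] at hv
      -- For `q < 1` the gap `(1 - q) w ^ q (1 - ⟪v, u⟫)` in the supporting inequality must vanish,
      -- which forces `v = u`.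
      have h1 := inner_profile_add_le (q := q) he hun hvn hw hq2.le
      rw [hv] at h1
      have h2 : 0 < (1 - q) * (1 + inner ℝ e (u : E n)) ^ q :=
        mul_pos (by linarith) (Real.rpow_pos_of_pos hw _)
      have h3 : 1 - inner ℝ (v : E n) (u : E n) ≤ 0 :=
        nonpos_of_mul_nonpos_right (by linarith) h2
      have h4 : ‖(v : E n) - u‖ ^ 2 ≤ 0 := by
        rw [@norm_sub_sq_real, hun, hvn]
        linarith
      have h5 : ‖(v : E n) - u‖ = 0 := by nlinarith [norm_nonneg ((v : E n) - u)]
      exact Subtype.ext (sub_eq_zero.1 (norm_eq_zero.1 h5))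
    refine ⟨hreg, ?_⟩
    rw [(gaussMap_eq_iff _ ⟨_, hreg⟩ u).2 hnormal]
    exact huη

end LpSurface

namespace LpSurface

open MeasureTheory Metric Set Filter Topology

variable {n : ℕ}

/-! ### The local behaviour of the parametrization -/

/-- The orthogonal projection to the tangent space of the subsphere. -/
theorem orthogonalProjectionOnto_tangent {L : Submodule ℝ (E n)} {u d : E n} (hu : u ∈ L)
    (hn : ‖u‖ = 1) (hd : d ∈ L) :
    (((ℝ ∙ u)ᗮ ⊓ L).orthogonalProjectionOnto d : E n) = d - inner ℝ u d • u := by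
  have hmem : d - inner ℝ u d • u ∈ (ℝ ∙ u)ᗮ ⊓ L := by
    refine ⟨Submodule.mem_orthogonal_singleton_iff_inner_right.2 ?_, L.sub_mem hd (L.smul_mem _ hu)⟩
    rw [inner_sub_right, inner_smul_right, real_inner_self_eq_norm_sq, hn]
    ring
  have hu0 : ((ℝ ∙ u)ᗮ ⊓ L).orthogonalProjectionOnto u = 0 := by
    rw [Submodule.orthogonalProjectionOnto_eq_zero_iff, Submodule.mem_orthogonal']
    intro w hw
    exact Submodule.mem_orthogonal_singleton_iff_inner_right.1 hw.1
  have h1 : ((ℝ ∙ u)ᗮ ⊓ L).orthogonalProjectionOnto (d - inner ℝ u d • u) =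
      ⟨d - inner ℝ u d • u, hmem⟩ :=
    Submodule.orthogonalProjectionOnto_mem_subspace_eq_self (K := (ℝ ∙ u)ᗮ ⊓ L) ⟨_, hmem⟩
  rw [map_sub, map_smul, hu0, smul_zero, sub_zero] at h1
  rw [h1]

/-- Near a point `u₁`, a strictly differentiable map on a subsphere is well approximated by its
differential on the tangent space. -/
theorem exists_nhds_approx {L : Submodule ℝ (E n)} {u₁ : E n} (hu₁ : u₁ ∈ L) (hn : ‖u₁‖ = 1)
    {z : E n → E n} {A : E n →L[ℝ] E n} (hz : HasStrictFDerivAt z A u₁)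
    {D : ((ℝ ∙ u₁)ᗮ ⊓ L : Submodule ℝ (E n)) →ₗ[ℝ] ((ℝ ∙ u₁)ᗮ ⊓ L : Submodule ℝ (E n))}
    (hD : LinearMap.ker D = ⊥) (hAD : ∀ x : ((ℝ ∙ u₁)ᗮ ⊓ L : Submodule ℝ (E n)), A x = D x) {c : ℝ} (hc : 0 < c) :
    ∃ U ∈ 𝓝 u₁, ∀ u ∈ U, ∀ v ∈ U, ‖u‖ = 1 → ‖v‖ = 1 → u ∈ L → v ∈ L →
      (1 - c) * ‖u - v‖ ≤ ‖((ℝ ∙ u₁)ᗮ ⊓ L).orthogonalProjectionOnto (u - v)‖ ∧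
      ‖z u - z v - D (((ℝ ∙ u₁)ᗮ ⊓ L).orthogonalProjectionOnto (u - v))‖ ≤
        c * ‖D (((ℝ ∙ u₁)ᗮ ⊓ L).orthogonalProjectionOnto (u - v))‖ := by
  obtain ⟨C, hC0, hC⟩ := D.exists_antilipschitzWith hD
  set M := 2 * (1 + ‖A‖) * (C + 1) with hM
  have hMpos : 0 < M := by positivity
  set δ : ℝ := min (min c (1 / 2)) (c / M) with hδ
  have hδ0 : 0 < δ := by positivity
  have hδc : δ ≤ c := (min_le_left _ _).trans (min_le_left _ _)
  have hδ2 : δ ≤ 1 / 2 := (min_le_left _ _).trans (min_le_right _ _)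
  have hδM : δ * M ≤ c := by
    have : δ ≤ c / M := min_le_right _ _
    rwa [le_div_iff₀ hMpos] at this
  obtain ⟨s, hs, hsA⟩ := hz.approximates_deriv_on_nhds (c := ⟨δ, hδ0.le⟩) (Or.inr hδ0)
  refine ⟨s ∩ ball u₁ δ, inter_mem hs (ball_mem_nhds _ hδ0), fun u hu v hv hun hvn huL hvL => ?_⟩
  set d := u - v with hd
  set x := ((ℝ ∙ u₁)ᗮ ⊓ L).orthogonalProjectionOnto d with hx
  have hdx : d = (x : E n) + inner ℝ u₁ d • u₁ := by
    rw [hx, orthogonalProjectionOnto_tangent (d := d) hu₁ hn (L.sub_mem huL hvL), sub_add_cancel]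
  -- A chord of the sphere is orthogonal to the sum of its endpoints, and half that sum is within
  -- `δ` of `u₁`; so `d` is almost tangent.
  have hperp : |inner ℝ u₁ d| ≤ δ * ‖d‖ := by
    have h1 : inner ℝ (u + v) d = 0 := by
      rw [hd, inner_add_left, inner_sub_right, inner_sub_right, real_inner_self_eq_norm_sq,
        real_inner_self_eq_norm_sq, hun, hvn, real_inner_comm]
      ring
    have h2 : inner ℝ u₁ d = inner ℝ (u₁ - (1 / 2 : ℝ) • (u + v)) d := by
      rw [inner_sub_left, real_inner_smul_left, h1]
      ring
    rw [h2]
    refine (abs_real_inner_le_norm _ _).trans ?_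
    gcongr
    have h3 : u₁ - (1 / 2 : ℝ) • (u + v) = (1 / 2 : ℝ) • ((u₁ - u) + (u₁ - v)) := by module
    have h4 : ‖u₁ - u‖ < δ := by simpa [dist_eq_norm, norm_sub_rev] using hu.2
    have h5 : ‖u₁ - v‖ < δ := by simpa [dist_eq_norm, norm_sub_rev] using hv.2
    rw [h3, norm_smul, Real.norm_of_nonneg (by norm_num)]
    have := norm_add_le (u₁ - u) (u₁ - v)
    linarith
  have hdn : ‖d‖ ≤ ‖x‖ + δ * ‖d‖ := by
    have h1 : ‖d‖ ≤ ‖(x : E n)‖ + ‖inner ℝ u₁ d • u₁‖ := by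
      nth_rewrite 1 [hdx]
      exact norm_add_le _ _
    rw [norm_smul, hn, mul_one, Real.norm_eq_abs] at h1
    exact h1.trans (add_le_add le_rfl hperp)
  have hd0 : 0 ≤ ‖d‖ := norm_nonneg _
  refine ⟨?_, ?_⟩
  · nlinarith
  · have h1 : ‖z u - z v - A d‖ ≤ δ * ‖d‖ := hsA u hu.1 v hv.1
    have h2 : z u - z v - (D x : E n) = (z u - z v - A d) + inner ℝ u₁ d • A u₁ := by
      have : A d = (D x : E n) + inner ℝ u₁ d • A u₁ := by
        nth_rewrite 1 [hdx]
        rw [map_add, map_smul, hAD]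
      rw [this]
      abel
    have h3 : ‖inner ℝ u₁ d • A u₁‖ ≤ δ * ‖d‖ * ‖A‖ := by
      rw [norm_smul, Real.norm_eq_abs]
      refine mul_le_mul hperp ?_ (norm_nonneg _) (by positivity)
      simpa [hn] using A.le_opNorm u₁
    have h4 : ‖d‖ ≤ 2 * ‖x‖ := by nlinarith
    have h5 : ‖x‖ ≤ C * ‖D x‖ := by
      have := hC.le_mul_dist x 0
      simpa [dist_zero_right] using this
    have h6 : 0 ≤ ‖D x‖ := norm_nonneg _
    rw [h2]
    calc ‖(z u - z v - A d) + inner ℝ u₁ d • A u₁‖ ≤ δ * ‖d‖ + δ * ‖d‖ * ‖A‖ :=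
          (norm_add_le _ _).trans (add_le_add h1 h3)
      _ = δ * (1 + ‖A‖) * ‖d‖ := by ring
      _ ≤ δ * (1 + ‖A‖) * (2 * ((C + 1) * ‖D x‖)) := by
          gcongr
          nlinarith
      _ = δ * M * ‖D x‖ := by rw [hM]; ring
      _ ≤ c * ‖D x‖ := by gcongr

/-- The factor of the identity in the differential of `profile`. -/
noncomputable def profileRadius (q w : ℝ) : ℝ := w ^ (q - 1) * ((1 - q) * w + q)

/-- Writing `w ^ (q - 1) = w ^ (q - 2) * w` collects the product-rule terms into a multiple of the
tangential part of `e`. Hence the differential preserves the tangent space and is there a rank one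
perturbation of a scalar. -/
theorem hasStrictFDerivAt_profile {e u : E n} {q : ℝ} (hw : 0 < 1 + inner ℝ e u) :
    ∃ A : E n →L[ℝ] E n, HasStrictFDerivAt (profile e q) A u ∧ ∀ v, A v =
      profileRadius q (1 + inner ℝ e u) • v -
        (q * (1 - q) * (1 + inner ℝ e u) ^ (q - 2) * inner ℝ e v) • (e - inner ℝ e u • u) := by
  set w := 1 + inner ℝ e u with hwdef
  have h1 : HasStrictFDerivAt (fun u : E n => 1 + inner ℝ e u) (innerSL ℝ e) u :=
    (innerSL ℝ e).hasStrictFDerivAt.const_add 1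
  have h2 : HasStrictFDerivAt (fun u : E n => (1 + inner ℝ e u) ^ (q - 1))
      (((q - 1) * w ^ (q - 1 - 1)) • innerSL ℝ e) u := by
    have h0 : HasStrictDerivAt (fun x : ℝ => x ^ (q - 1)) ((q - 1) * w ^ (q - 1 - 1))
        (1 + inner ℝ e u) := Real.hasStrictDerivAt_rpow_const_of_ne hw.ne' (q - 1)
    exact h0.comp_hasStrictFDerivAt u h1
  have h3 : HasStrictFDerivAt (fun u : E n => (1 - q) * (1 + inner ℝ e u) + q)
      ((1 - q) • innerSL ℝ e) u := (h1.const_mul (1 - q)).add_const q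
  have h4 := h2.smul ((h3.smul (hasStrictFDerivAt_id u)).add_const (q • e))
  refine ⟨_, h4, fun v => ?_⟩
  have h5 : w ^ (q - 1) = w ^ (q - 2) * w := by
    have : q - 2 = q - 1 - 1 := by ring
    rw [this, rpow_sub_one_mul hw]
  have h6 : q - 1 - 1 = q - 2 := by ring
  have h7 : inner ℝ e u = w - 1 := by rw [hwdef]; ring
  have h8 : 1 + inner ℝ e u = w := rfl
  simp only [add_apply, smul_apply, ContinuousLinearMap.smulRight_apply, ContinuousLinearMap.id_apply,
    innerSL_apply_apply, smul_eq_mul, id, Pi.smul_apply', h8, h6, profileRadius, h5]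
  rw [h7]
  module

/-- The determinant of a rank one perturbation of a multiple of the identity. -/
theorem det_smul_id_sub {X : Type*} [NormedAddCommGroup X] [InnerProductSpace ℝ X]
    [FiniteDimensional ℝ X] {G : ℝ} (hG : G ≠ 0) (κ : ℝ) (p : X) :
    LinearMap.det (G • LinearMap.id - κ • (innerSL ℝ p).toLinearMap.smulRight p) =
      G ^ Module.finrank ℝ X * (1 - κ / G * ‖p‖ ^ 2) := by
  have h : G • LinearMap.id - κ • (innerSL ℝ p).toLinearMap.smulRight p =
      G • LinearMap.transvection (-(κ / G) • (innerSL ℝ p).toLinearMap) p := by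
    refine LinearMap.ext fun x => ?_
    simp only [LinearMap.sub_apply, LinearMap.smul_apply, LinearMap.id_apply,
      LinearMap.smulRight_apply, LinearMap.transvection.apply, ContinuousLinearMap.coe_coe,
      innerSL_apply_apply, smul_eq_mul, smul_add, smul_smul]
    have h1 : G * (-(κ / G) * inner ℝ p x) = -(κ * inner ℝ p x) := by field_simp
    rw [h1]
    module
  rw [h, LinearMap.det_smul, LinearMap.transvection.det]
  simp only [LinearMap.smul_apply, ContinuousLinearMap.coe_coe, innerSL_apply_apply,
    real_inner_self_eq_norm_sq, smul_eq_mul]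
  ring

end LpSurface

/-! ### Surface area density of `coneBody` -/

namespace LpSurface

open MeasureTheory Metric Set Filter Topology

variable {n : ℕ}

/-- The product of the principal radii of `profile`, up to a power of `w = 1 + ⟪e, u⟫`. -/
noncomputable def radiiProduct (q : ℝ) (m : ℕ) (w : ℝ) : ℝ :=
  ((1 - q) * w + q) ^ (m - 1) * ((1 - q ^ 2) * w + q * (2 * q - 1))

theorem radiiProduct_pos {q : ℝ} (hq : 1 / 2 < q) (hq1 : q < 1) (m : ℕ) {w : ℝ} (hw : 0 ≤ w) :
    0 < radiiProduct q m w := by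
  have h1 : 0 ≤ (1 - q) * w := mul_nonneg (by linarith) hw
  have h2 : 0 ≤ (1 - q ^ 2) * w := mul_nonneg (by nlinarith) hw
  have h3 : 0 < q * (2 * q - 1) := mul_pos (by linarith) (by linarith)
  exact mul_pos (pow_pos (by linarith) _) (by linarith)

/-- The differential of `profile` on the tangent space of the subsphere, and its determinant. -/
theorem exists_tangentMap {m : ℕ} (hm : 1 ≤ m) {L : Submodule ℝ (E n)}
    (hL : Module.finrank ℝ L = m + 1) {e u : E n} (he : ‖e‖ = 1) (heL : e ∈ L) (hu : ‖u‖ = 1)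
    (huL : u ∈ L) {q : ℝ} (hq : 1 / 2 < q) (hq1 : q < 1) (hw : 0 < 1 + inner ℝ e u) :
    ∃ (A : E n →L[ℝ] E n)
      (D : ((ℝ ∙ u)ᗮ ⊓ L : Submodule ℝ (E n)) →ₗ[ℝ] ((ℝ ∙ u)ᗮ ⊓ L : Submodule ℝ (E n))),
      HasStrictFDerivAt (profile e q) A u ∧
      (∀ x : ((ℝ ∙ u)ᗮ ⊓ L : Submodule ℝ (E n)), A x = D x) ∧
      LinearMap.det D =
        ((1 + inner ℝ e u) ^ (q - 1)) ^ m * radiiProduct q m (1 + inner ℝ e u) := by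
  obtain ⟨A, hA, hAv⟩ := hasStrictFDerivAt_profile (q := q) hw
  have hu0 : u ≠ 0 := norm_ne_zero_iff.1 (by rw [hu]; exact one_ne_zero)
  set w := 1 + inner ℝ e u with hwdef
  have hwe : inner ℝ e u = w - 1 := by rw [hwdef]; ring
  have hpmem : e - inner ℝ e u • u ∈ (ℝ ∙ u)ᗮ ⊓ L := by
    refine ⟨Submodule.mem_orthogonal_singleton_iff_inner_right.2 ?_, L.sub_mem heL (L.smul_mem _ huL)⟩
    rw [inner_sub_right, inner_smul_right, real_inner_self_eq_norm_sq, hu, real_inner_comm]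
    ring
  set p : ((ℝ ∙ u)ᗮ ⊓ L : Submodule ℝ (E n)) := ⟨e - inner ℝ e u • u, hpmem⟩ with hp
  have hpn : ‖p‖ ^ 2 = w * (2 - w) := by
    change ‖e - inner ℝ e u • u‖ ^ 2 = _
    rw [@norm_sub_sq_real, inner_smul_right, norm_smul, he, hu, hwe, Real.norm_eq_abs, mul_one, sq_abs]
    ring
  have hG : profileRadius q w ≠ 0 := by
    refine (mul_pos (Real.rpow_pos_of_pos hw _) ?_).ne'
    have : 0 < (1 - q) * w := mul_pos (by linarith) hw
    linarith
  refine ⟨A, profileRadius q w • LinearMap.id -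
    (q * (1 - q) * w ^ (q - 2)) • (innerSL ℝ p).toLinearMap.smulRight p, hA, fun x => ?_, ?_⟩
  · have h1 : inner ℝ e (x : E n) = inner ℝ p x := by
      have h2 : inner ℝ u (x : E n) = 0 :=
        Submodule.mem_orthogonal_singleton_iff_inner_right.1 x.2.1
      change _ = inner ℝ (e - inner ℝ e u • u) (x : E n)
      rw [inner_sub_left, real_inner_smul_left, h2, mul_zero, sub_zero]
    rw [hAv, h1]
    simp [smul_smul, hp]
  · rw [det_smul_id_sub hG, finrank_orthogonal_span_inf hL huL hu0, hpn]
    -- One factor `profileRadius` is combined with the rank one correction into the radius in the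
    -- direction of `e`; the other `m - 1` radii are equal.
    obtain ⟨j, rfl⟩ : ∃ j, m = j + 1 := ⟨m - 1, by omega⟩
    have h5 : w ^ (q - 1) = w ^ (q - 2) * w := by
      have : q - 2 = q - 1 - 1 := by ring
      rw [this, rpow_sub_one_mul hw]
    have h6 : profileRadius q w ^ (j + 1) *
        (1 - q * (1 - q) * w ^ (q - 2) / profileRadius q w * (w * (2 - w))) =
        profileRadius q w ^ j * (profileRadius q w - q * (1 - q) * (w ^ (q - 2) * w) * (2 - w)) := by
      field_simp
      ring
    rw [h6, ← h5, profileRadius, radiiProduct, Nat.add_sub_cancel, mul_pow]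
    ring

/-- The density of the surface area measure of `coneBody` on the subsphere, in terms of
`w = 1 + ⟪e, u⟫`. -/
noncomputable def coneBodyDensity (L : Submodule ℝ (E n)) (q : ℝ) (m k : ℕ) (w : ℝ) : ℝ :=
  ((w ^ (q - 1)) ^ m * radiiProduct q m w) * (w ^ q * ((1 - q) * w + (2 * q - 1))) ^ k *
    (volume (ball (0 : Lᗮ) 1)).toReal

theorem coe_pow_mul_ofReal {d s β : ℝ} {r : ℝ≥0} {k : ℕ} :
    (r : ℝ≥0∞) ^ k * ENNReal.ofReal (d * s ^ k * β) = ENNReal.ofReal (d * (r * s) ^ k * β) := by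
  rw [← ENNReal.ofReal_coe_nnreal, ← ENNReal.ofReal_pow r.coe_nonneg,
    ← ENNReal.ofReal_mul (by positivity)]
  congr 1
  ring

set_option maxHeartbeats 1000000 in
/-- The surface area measure of `coneBody` near a normal `u₁ ∈ L` is approximately a multiple of
the Hausdorff measure. -/
theorem exists_nhds_surfaceAreaMeasure_coneBody {m k : ℕ} (hm : 1 ≤ m) {L : Submodule ℝ (E n)}
    (hL : Module.finrank ℝ L = m + 1) (hk : Module.finrank ℝ Lᗮ = k) {e : E n} {he : ‖e‖ = 1}
    {heL : e ∈ L} {q : ℝ} {hq : 0 ≤ q} (hq2 : 1 / 2 < q) (hq1 : q < 1) {u₁ : subsphere L}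
    (hw : 0 < 1 + inner ℝ e ((u₁ : Sphere n) : E n)) {r : ℝ≥0} (hr : 1 < r) :
    ∃ U ∈ 𝓝 u₁, ∀ η ⊆ U, MeasurableSet η →
      surfaceAreaMeasure (coneBody L e he heL q hq) (Subtype.val '' η) ≤
        (r : ℝ≥0∞) ^ (n - 1 + k) * (ENNReal.ofReal
          (coneBodyDensity L q m k (1 + inner ℝ e ((u₁ : Sphere n) : E n))) * μHE[m] η) ∧
      ENNReal.ofReal (coneBodyDensity L q m k (1 + inner ℝ e ((u₁ : Sphere n) : E n))) * μHE[m] η ≤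
        (r : ℝ≥0∞) ^ (n - 1 + k + m) *
          surfaceAreaMeasure (coneBody L e he heL q hq) (Subtype.val '' η) := by
  set a : E n := ((u₁ : Sphere n) : E n) with ha
  have hau : ‖a‖ = 1 := norm_eq_of_mem_sphere _
  have haL : a ∈ L := u₁.2
  have ha0 : a ≠ 0 := norm_ne_zero_iff.1 (by rw [hau]; exact one_ne_zero)
  set w := 1 + inner ℝ e a with hwdef
  set X := (ℝ ∙ a)ᗮ ⊓ L with hX
  obtain ⟨A, D, hA, hAD, hdet⟩ := exists_tangentMap hm hL he heL hau haL hq2 hq1 hw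
  have hXfin : Module.finrank ℝ X = m := finrank_orthogonal_span_inf hL haL ha0
  have hnmk : n - 1 = Module.finrank ℝ X + Module.finrank ℝ Lᗮ := by
    have := L.finrank_add_finrank_orthogonal
    rw [finrank_euclideanSpace_fin] at this
    omega
  have hr0 : 0 < r := one_pos.trans hr
  have hr1 : (1 : ℝ) < r := by exact_mod_cast hr
  have hr0' : (0 : ℝ) < r := by exact_mod_cast hr0
  have hdetpos : 0 < LinearMap.det D := by
    rw [hdet]
    exact mul_pos (pow_pos (Real.rpow_pos_of_pos hw _) _) (radiiProduct_pos hq2 hq1 m hw.le)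
  have hDker : LinearMap.ker D = ⊥ := by
    by_contra h
    exact hdetpos.ne' (LinearMap.det_eq_zero_iff_ker_ne_bot.2 h)
  -- With this error `1 - c = r⁻¹` and `1 + c ≤ r`, so both comparison maps below have Lipschitz
  -- constant `r`.
  set c : ℝ := 1 - (r : ℝ)⁻¹ with hc
  have hc0 : 0 < c := by
    rw [hc, sub_pos]
    exact inv_lt_one_of_one_lt₀ hr1
  obtain ⟨U, hU, hUapp⟩ := exists_nhds_approx haL hau hA hDker hAD hc0
  set t : E n → ℝ := fun u => inner ℝ e (profile e q u) with ht
  have hta : t a = w ^ q * ((1 - q) * w + (2 * q - 1)) := inner_axis_profile he hw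
  have hta0 : 0 < t a := inner_axis_profile_pos he hq2 hq1.le hw
  have htc : ContinuousAt t a := continuousAt_const.inner hA.continuousAt
  -- Near `a` the fibre radius changes by a factor of at most `r`, at the cost of `r ^ k` in the
  -- fibre volume.
  have hup : ∀ᶠ u in 𝓝 a, t u < r * t a :=
    htc.eventually_lt_const (lt_mul_of_one_lt_left hta0 hr1)
  have hlow : ∀ᶠ u in 𝓝 a, t a / r < t u :=
    htc.eventually_const_lt (div_lt_self hta0 hr1)
  have hwpos : ∀ᶠ u in 𝓝 a, 0 < 1 + inner ℝ e u :=
    (Continuous.continuousAt (by fun_prop)).eventually_const_lt hw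
  have hnhds : {u : E n | u ∈ U ∧ t u < r * t a ∧ t a / r < t u ∧ 0 < 1 + inner ℝ e u} ∈ 𝓝 a :=
    inter_mem hU (hup.and (hlow.and hwpos))
  have hcont : Continuous fun u : subsphere L => ((u : Sphere n) : E n) := by fun_prop
  refine ⟨_, hcont.continuousAt.preimage_mem_nhds hnhds, fun η hη hηm => ?_⟩
  set P : subsphere L → X := fun u => X.orthogonalProjectionOnto ((u : Sphere n) : E n) with hP
  have hunit : ∀ u : subsphere L, ‖((u : Sphere n) : E n)‖ = 1 := fun u => norm_eq_of_mem_sphere _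
  -- the subsphere is compared with its projection to the tangent space
  have hvol : (μHE[m] : Measure X) = volume := by
    rw [← hXfin, InnerProductSpace.euclideanHausdorffMeasure_eq_volume]
  have hPle : volume (P '' η) ≤ μHE[m] η := by
    have h1 := euclideanHausdorffMeasure_image_le_of_dist_le (f := P) (g := id) (s := η) (C := 1) m
      (fun u _ v _ => by
        rw [NNReal.coe_one, one_mul, id, id, Subtype.dist_eq u v, Subtype.dist_eq (u : Sphere n),
          dist_eq_norm, dist_eq_norm, hP, ← map_sub]
        exact Submodule.norm_orthogonalProjectionOnto_apply_le X _)
    rw [image_id, ENNReal.coe_one, one_pow, one_mul] at h1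
    rwa [hvol] at h1
  have hleP : μHE[m] η ≤ (r : ℝ≥0∞) ^ m * volume (P '' η) := by
    have h1 := euclideanHausdorffMeasure_image_le_of_dist_le (f := id) (g := P) (s := η) (C := r) m
      (fun u hu v hv => by
        have h2 := (hUapp _ (hη hu).1 _ (hη hv).1 (hunit u) (hunit v) u.2 v.2).1
        rw [id, id, Subtype.dist_eq u v, Subtype.dist_eq (u : Sphere n), dist_eq_norm, dist_eq_norm,
          hP, ← map_sub]
        rw [hc, sub_sub_cancel, inv_mul_le_iff₀ hr0'] at h2
        exact h2)
    rw [image_id] at h1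
    rwa [hvol] at h1
  -- the boundary is compared with a product set
  set f : Sphere n × Lᗮ → E n := fun i => profile e q i.1 + i.2 with hf
  set g : Sphere n × Lᗮ → WithLp 2 (X × Lᗮ) := fun i =>
    WithLp.toLp 2 (D (X.orthogonalProjectionOnto (i.1 : E n)), i.2) with hg
  set S : Set (Sphere n × Lᗮ) := {i | i.1 ∈ Subtype.val '' η ∧ ‖i.2‖ < t i.1} with hS
  have hSK : surfaceAreaMeasure (coneBody L e he heL q hq) (Subtype.val '' η) = μHE[n - 1] (f '' S) := by
    rw [surfaceAreaMeasure_apply _ ((MeasurableEmbedding.subtype_coe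
      (measurableSet_subsphere L)).measurableSet_image.2 hηm), image_gaussMap_preimage,
      image_gaussMap_preimage_coneBody hq2 hq1]
    rintro _ ⟨u, hu, rfl⟩
    exact ⟨u.2, (hη hu).2.2.2⟩
  have hdist : ∀ i ∈ S, ∀ j ∈ S, dist (f i) (f j) ≤ r * dist (g i) (g j) ∧
      dist (g i) (g j) ≤ r * dist (f i) (f j) := by
    rintro ⟨_, y⟩ ⟨⟨u, hu, rfl⟩, -⟩ ⟨_, y'⟩ ⟨⟨v, hv, rfl⟩, -⟩
    have h1 := (hUapp _ (hη hu).1 _ (hη hv).1 (hunit u) (hunit v) u.2 v.2).2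
    set x := D (X.orthogonalProjectionOnto (((u : Sphere n) : E n) - ((v : Sphere n) : E n))) with hx
    have hgn : dist (g ((u : Sphere n), y)) (g ((v : Sphere n), y')) =
        ‖(x : E n) + ((y - y' : Lᗮ) : E n)‖ := by
      have h2 : g ((u : Sphere n), y) - g ((v : Sphere n), y') = WithLp.toLp 2 (x, y - y') := by
        simp only [hg, hx, map_sub]
        rfl
      rw [dist_eq_norm, h2, ← sq_eq_sq₀ (norm_nonneg _) (norm_nonneg _),
        WithLp.prod_norm_sq_eq_of_L2, @norm_add_sq_real,
        Submodule.inner_right_of_mem_orthogonal (Submodule.mem_inf.1 x.2).2 (y - y').2]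
      simp
    have hxg : ‖x‖ ≤ dist (g ((u : Sphere n), y)) (g ((v : Sphere n), y')) := by
      rw [hgn, ← sq_le_sq₀ (norm_nonneg _) (norm_nonneg _), @norm_add_sq_real,
        Submodule.inner_right_of_mem_orthogonal (Submodule.mem_inf.1 x.2).2 (y - y').2]
      have : 0 ≤ ‖((y - y' : Lᗮ) : E n)‖ ^ 2 := by positivity
      rw [Submodule.coe_norm]
      linarith
    have hfd : dist (f ((u : Sphere n), y)) (f ((v : Sphere n), y')) =
        ‖((x : E n) + ((y - y' : Lᗮ) : E n)) +
          (profile e q ((u : Sphere n) : E n) - profile e q ((v : Sphere n) : E n) - x)‖ := by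
      rw [dist_eq_norm]
      congr 1
      simp only [hf]
      push_cast
      abel
    have h3 := norm_add_le ((x : E n) + ((y - y' : Lᗮ) : E n))
      (profile e q ((u : Sphere n) : E n) - profile e q ((v : Sphere n) : E n) - x)
    have h4 := norm_sub_le_norm_add ((x : E n) + ((y - y' : Lᗮ) : E n))
      (profile e q ((u : Sphere n) : E n) - profile e q ((v : Sphere n) : E n) - x)
    rw [← hfd, ← hgn] at h3 h4
    have h5 : c * ‖x‖ ≤ c * dist (g ((u : Sphere n), y)) (g ((v : Sphere n), y')) := by gcongr
    have hd0 : 0 ≤ dist (g ((u : Sphere n), y)) (g ((v : Sphere n), y')) := dist_nonneg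
    have hcr : 1 + c ≤ r := by
      rw [hc]
      have : 0 < ((r : ℝ) - 1) ^ 2 / r := by
        have : (0 : ℝ) < r - 1 := by linarith
        positivity
      have h6 : ((r : ℝ) - 1) ^ 2 / r = r - 2 + (r : ℝ)⁻¹ := by field_simp; ring
      linarith
    constructor
    · nlinarith
    · rw [← inv_mul_le_iff₀ hr0']
      have : (r : ℝ)⁻¹ = 1 - c := by rw [hc]; ring
      rw [this]
      linarith
  have hfg := euclideanHausdorffMeasure_image_le_of_dist_le (n - 1)
    (fun i hi j hj => (hdist i hi j hj).1)
  have hgf := euclideanHausdorffMeasure_image_le_of_dist_le (n - 1)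
    (fun i hi j hj => (hdist i hi j hj).2)
  set β := volume (ball (0 : Lᗮ) 1) with hβ
  have hβfin : β ≠ ∞ := measure_ball_lt_top.ne
  have hprod : ∀ s : ℝ, 0 < s → (μHE[n - 1] : Measure (WithLp 2 (X × Lᗮ)))
      (WithLp.toLp 2 '' ((D '' (P '' η)) ×ˢ ball (0 : Lᗮ) s)) =
      ENNReal.ofReal (LinearMap.det D * s ^ k * β.toReal) * volume (P '' η) := by
    intro s hs
    rw [hnmk, euclideanHausdorffMeasure_toLp_image_prod, Measure.addHaar_image_linearMap,
      abs_of_pos hdetpos, Measure.addHaar_ball_of_pos volume _ hs, hk,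
      ENNReal.ofReal_mul (by positivity), ENNReal.ofReal_mul (by positivity),
      ENNReal.ofReal_toReal hβfin]
    ring
  have hdens : coneBodyDensity L q m k w = LinearMap.det D * t a ^ k * β.toReal := by
    rw [coneBodyDensity, hdet, hta]
  have hβ0 : 0 ≤ β.toReal := ENNReal.toReal_nonneg
  constructor
  · have hsub : g '' S ⊆ WithLp.toLp 2 '' ((D '' (P '' η)) ×ˢ ball (0 : Lᗮ) (r * t a)) := by
      rintro _ ⟨⟨_, y⟩, ⟨⟨u, hu, rfl⟩, hy⟩, rfl⟩
      refine ⟨_, ⟨⟨P u, ⟨u, hu, rfl⟩, rfl⟩, ?_⟩, rfl⟩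
      rw [mem_ball_zero_iff]
      exact hy.trans (hη hu).2.1
    rw [hSK, hdens]
    refine hfg.trans ?_
    rw [pow_add, mul_assoc]
    gcongr
    refine (measure_mono hsub).trans ?_
    rw [hprod _ (by positivity), ← mul_assoc]
    rw [coe_pow_mul_ofReal]
    gcongr
  · have hsub : WithLp.toLp 2 '' ((D '' (P '' η)) ×ˢ ball (0 : Lᗮ) (t a / r)) ⊆ g '' S := by
      rintro _ ⟨⟨_, y⟩, ⟨⟨_, ⟨u, hu, rfl⟩, rfl⟩, hy⟩, rfl⟩
      refine ⟨((u : Sphere n), y), ⟨⟨u, hu, rfl⟩, ?_⟩, rfl⟩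
      rw [mem_ball_zero_iff] at hy
      exact hy.trans (hη hu).2.2.1
    rw [hSK, hdens]
    have h1 : ENNReal.ofReal (LinearMap.det D * t a ^ k * β.toReal) =
        (r : ℝ≥0∞) ^ k * ENNReal.ofReal (LinearMap.det D * (t a / r) ^ k * β.toReal) := by
      rw [coe_pow_mul_ofReal, mul_div_cancel₀ _ hr0'.ne']
    calc ENNReal.ofReal (LinearMap.det D * t a ^ k * β.toReal) * μHE[m] η
        ≤ ENNReal.ofReal (LinearMap.det D * t a ^ k * β.toReal) *
          ((r : ℝ≥0∞) ^ m * volume (P '' η)) := by gcongr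
      _ = (r : ℝ≥0∞) ^ (k + m) * (ENNReal.ofReal (LinearMap.det D * (t a / r) ^ k * β.toReal) *
          volume (P '' η)) := by rw [h1]; ring
      _ = (r : ℝ≥0∞) ^ (k + m) * (μHE[n - 1] : Measure (WithLp 2 (X × Lᗮ)))
          (WithLp.toLp 2 '' ((D '' (P '' η)) ×ˢ ball (0 : Lᗮ) (t a / r))) := by
        rw [hprod _ (by positivity)]
      _ ≤ (r : ℝ≥0∞) ^ (k + m) * ((r : ℝ≥0∞) ^ (n - 1) * μHE[n - 1] (f '' S)) := by
        gcongr
        exact (measure_mono hsub).trans hgf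
      _ = (r : ℝ≥0∞) ^ (n - 1 + k + m) * μHE[n - 1] (f '' S) := by ring

end LpSurface

namespace LpSurface

open MeasureTheory Metric Set Filter Topology

/-! ### The density of the `L_p` surface area measure of `coneBody` -/

variable {n : ℕ} {L : Submodule ℝ (E n)} {e : E n} {he : ‖e‖ = 1} {heL : e ∈ L} {q : ℝ} {hq : 0 ≤ q}

/-- Normals outside `L` at regular points have support value zero, and `1 - p > 0` makes their
weight vanish. -/
theorem lpSurfaceAreaMeasure_coneBody_support_subset {p : ℝ} (hp : p < 1) :
    (lpSurfaceAreaMeasure p (coneBody L e he heL q hq)).support ⊆ subsphere L := by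
  refine Measure.support_subset_of_isClosed
    (L.closed_of_finiteDimensional.preimage continuous_subtype_val) ?_
  have hm : MeasurableSet ({u : Sphere n | ENNReal.ofReal (supportFunction
      (coneBody L e he heL q hq) (u : E n) ^ (1 - p)) ≠ 0} ∩ (subsphere L)ᶜ) :=
    (measurableSet_eq_fun (measurable_lpWeight p _) measurable_const).compl.inter
      (measurableSet_subsphere L).compl
  rw [mem_ae_iff, lpSurfaceAreaMeasure, withDensity_apply_eq_zero (measurable_lpWeight p _),
    surfaceAreaMeasure_apply _ hm]
  refine measure_mono_null (t := ∅) ?_ measure_empty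
  rintro _ ⟨x, ⟨hx, hxL⟩, rfl⟩
  refine hx ?_
  rw [supportFunction_gaussMap_eq_zero x hxL, Real.zero_rpow (by linarith), ENNReal.ofReal_zero]

/-- The density of the `L_p` surface area measure of `coneBody` for the critical exponent, in terms
of `w = 1 + ⟪e, u⟫`. -/
noncomputable def lpConeDensity (L : Submodule ℝ (E n)) (q : ℝ) (m k : ℕ) (w : ℝ) : ℝ :=
  radiiProduct q m w * ((1 - q) * w + (2 * q - 1)) ^ k * (volume (ball (0 : Lᗮ) 1)).toReal

theorem lpConeDensity_pos (hq2 : 1 / 2 < q) (hq1 : q < 1) (m k : ℕ) {w : ℝ} (hw : 0 ≤ w) :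
    0 < lpConeDensity L q m k w := by
  have h1 : 0 ≤ (1 - q) * w := mul_nonneg (by linarith) hw
  exact mul_pos (mul_pos (radiiProduct_pos hq2 hq1 m hw) (pow_pos (by linarith) _))
    (ENNReal.toReal_pos (measure_ball_pos _ _ one_pos).ne' measure_ball_lt_top.ne)

theorem continuous_lpConeDensity (m k : ℕ) : Continuous (lpConeDensity L q m k) := by
  unfold lpConeDensity radiiProduct
  fun_prop

/-- The total exponent of `w` is `q (1 - p) + (q - 1) m + q k`, which `hqm` makes zero; this
condition dictates the choice of `q`. -/
theorem rpow_mul_coneBodyDensity {m k : ℕ} {p w : ℝ} (hw : 0 < w) (hqm : q * (m + 1 - p + k) = m) :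
    (w ^ q) ^ (1 - p) * coneBodyDensity L q m k w = lpConeDensity L q m k w := by
  have h : (w ^ q) ^ (1 - p) * (w ^ (q - 1)) ^ m * (w ^ q) ^ k = 1 := by
    rw [← Real.rpow_mul hw.le, ← Real.rpow_mul_natCast hw.le, ← Real.rpow_mul_natCast hw.le,
      ← Real.rpow_add hw, ← Real.rpow_add hw]
    have : q * (1 - p) + (q - 1) * m + q * k = 0 := by linarith
    rw [this, Real.rpow_zero]
  rw [coneBodyDensity, lpConeDensity, mul_pow]
  linear_combination (radiiProduct q m w * ((1 - q) * w + (2 * q - 1)) ^ k *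
    (volume (ball (0 : Lᗮ) 1)).toReal) * h

theorem lpSurfaceAreaMeasure_comap_apply (p : ℝ) (K : ConvexBody (E n)) {η : Set (subsphere L)}
    (hη : MeasurableSet η) :
    (lpSurfaceAreaMeasure p K).comap (Subtype.val : subsphere L → Sphere n) η =
      ∫⁻ u in Subtype.val '' η, ENNReal.ofReal (supportFunction K (u : E n) ^ (1 - p))
        ∂surfaceAreaMeasure K := by
  have hemb := MeasurableEmbedding.subtype_coe (measurableSet_subsphere L)
  rw [hemb.comap_apply, lpSurfaceAreaMeasure, withDensity_apply _ (hemb.measurableSet_image.2 hη)]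

theorem exists_one_lt_pow_eq {r : ℝ≥0} (hr : 1 < r) {j : ℕ} (hj : j ≠ 0) :
    ∃ s : ℝ≥0, 1 < s ∧ s ^ j = r := by
  refine ⟨r ^ ((j : ℝ)⁻¹), NNReal.one_lt_rpow hr (by positivity), ?_⟩
  rw [← NNReal.rpow_natCast, ← NNReal.rpow_mul, inv_mul_cancel₀ (by positivity), NNReal.rpow_one]

/-- The `L_p` surface area measure of `coneBody` near a normal `u₁ ∈ L`. -/
theorem exists_nhds_lpSurfaceAreaMeasure_coneBody {m k : ℕ} (hm : 1 ≤ m)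
    (hL : Module.finrank ℝ L = m + 1) (hk : Module.finrank ℝ Lᗮ = k) (hn : 1 ≤ n) (hq2 : 1 / 2 < q)
    (hq1 : q < 1) {p : ℝ} (hqm : q * (m + 1 - p + k) = m) {u₁ : subsphere L}
    (hw : 0 < 1 + inner ℝ e ((u₁ : Sphere n) : E n)) {r : ℝ≥0} (hr : 1 < r) :
    ∃ U ∈ 𝓝 u₁, ∀ η ⊆ U, MeasurableSet η →
      (lpSurfaceAreaMeasure p (coneBody L e he heL q hq)).comap Subtype.val η ≤
        r * (ENNReal.ofReal
          (lpConeDensity L q m k (1 + inner ℝ e ((u₁ : Sphere n) : E n))) * μHE[m] η) ∧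
      ENNReal.ofReal (lpConeDensity L q m k (1 + inner ℝ e ((u₁ : Sphere n) : E n))) * μHE[m] η ≤
        r * (lpSurfaceAreaMeasure p (coneBody L e he heL q hq)).comap Subtype.val η := by
  -- `n - 1 + k + m` factors `s` are used for the surface area measure and one more for the weight.
  obtain ⟨s, hs, rfl⟩ := exists_one_lt_pow_eq hr (j := n + k + m) (by omega)
  set w := 1 + inner ℝ e ((u₁ : Sphere n) : E n) with hwdef
  set K := coneBody L e he heL q hq with hK
  obtain ⟨U, hU, hUs⟩ := exists_nhds_surfaceAreaMeasure_coneBody (he := he) (heL := heL) (hq := hq)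
    hm hL hk hq2 hq1 hw hs
  have hs0 : (0 : ℝ) < s := by exact_mod_cast one_pos.trans hs
  have hs1 : (1 : ℝ) < s := by exact_mod_cast hs
  set W : Sphere n → ℝ≥0∞ := fun u => ENNReal.ofReal (supportFunction K (u : E n) ^ (1 - p)) with hW
  set c := (w ^ q) ^ (1 - p) with hc
  have hwq : 0 < w ^ q := Real.rpow_pos_of_pos hw q
  have hc0 : 0 < c := Real.rpow_pos_of_pos hwq _
  have hval : supportFunction K ((u₁ : Sphere n) : E n) = w ^ q :=
    supportFunction_coneBody hq2 hq1.le u₁.2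
  have hcont : ContinuousAt
      (fun u : subsphere L => supportFunction K ((u : Sphere n) : E n) ^ (1 - p)) u₁ := by
    refine ContinuousAt.rpow_const ?_ (Or.inl ?_)
    · exact ((continuous_supportFunction K).comp
        (continuous_subtype_val.comp continuous_subtype_val)).continuousAt
    · rw [hval]
      exact hwq.ne'
  have hup : ∀ᶠ u : subsphere L in 𝓝 u₁, supportFunction K ((u : Sphere n) : E n) ^ (1 - p) < s * c :=
    hcont.eventually_lt_const (by beta_reduce; rw [hval]; exact lt_mul_of_one_lt_left hc0 hs1)
  have hlow : ∀ᶠ u : subsphere L in 𝓝 u₁, c / s < supportFunction K ((u : Sphere n) : E n) ^ (1 - p) :=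
    hcont.eventually_const_lt (by beta_reduce; rw [hval]; exact div_lt_self hc0 hs1)
  refine ⟨_, inter_mem hU (hup.and hlow), fun η hη hηm => ?_⟩
  obtain ⟨h1, h2⟩ := hUs η (hη.trans inter_subset_left) hηm
  have hmeas : MeasurableSet (Subtype.val '' η) :=
    (MeasurableEmbedding.subtype_coe (measurableSet_subsphere L)).measurableSet_image.2 hηm
  have hWup : ∀ u ∈ Subtype.val '' η, W u ≤ s * ENNReal.ofReal c := by
    rintro _ ⟨u, hu, rfl⟩
    rw [← ENNReal.ofReal_coe_nnreal, ← ENNReal.ofReal_mul hs0.le]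
    exact ENNReal.ofReal_le_ofReal (hη hu).2.1.le
  have hWlow : ∀ u ∈ Subtype.val '' η, ENNReal.ofReal c ≤ s * W u := by
    rintro _ ⟨u, hu, rfl⟩
    rw [← ENNReal.ofReal_coe_nnreal, ← ENNReal.ofReal_mul hs0.le]
    refine ENNReal.ofReal_le_ofReal ?_
    have h := (hη hu).2.2.le
    rwa [div_le_iff₀' hs0] at h
  have hdens : ENNReal.ofReal (lpConeDensity L q m k w) =
      ENNReal.ofReal c * ENNReal.ofReal (coneBodyDensity L q m k w) := by
    rw [← ENNReal.ofReal_mul hc0.le, rpow_mul_coneBodyDensity hw hqm]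
  have hWm : Measurable W := measurable_lpWeight p K
  have hexp : n + k + m = n - 1 + k + m + 1 := by omega
  rw [lpSurfaceAreaMeasure_comap_apply p K hηm, hdens, ENNReal.coe_pow, hexp]
  have hone : (1 : ℝ≥0∞) ≤ s := by exact_mod_cast hs.le
  set ν := (μHE[m] : Measure (subsphere L)) η
  set σ := surfaceAreaMeasure K (Subtype.val '' η) with hσ
  set d := ENNReal.ofReal (coneBodyDensity L q m k w)
  constructor
  · calc ∫⁻ u in Subtype.val '' η, W u ∂surfaceAreaMeasure K
        ≤ ∫⁻ _ in Subtype.val '' η, s * ENNReal.ofReal c ∂surfaceAreaMeasure K :=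
          setLIntegral_mono measurable_const hWup
      _ = s * ENNReal.ofReal c * σ := setLIntegral_const _ _
      _ ≤ s * ENNReal.ofReal c * ((s : ℝ≥0∞) ^ (n - 1 + k) * (d * ν)) := by gcongr
      _ = (s : ℝ≥0∞) ^ (n - 1 + k + 1) * (ENNReal.ofReal c * d * ν) := by ring
      _ ≤ (s : ℝ≥0∞) ^ (n - 1 + k + m + 1) * (ENNReal.ofReal c * d * ν) := by
        gcongr ?_ * _
        exact pow_le_pow_right₀ hone (by omega)
  · calc ENNReal.ofReal c * d * ν = ENNReal.ofReal c * (d * ν) := mul_assoc _ _ _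
      _ ≤ ENNReal.ofReal c * ((s : ℝ≥0∞) ^ (n - 1 + k + m) * σ) := by gcongr
      _ = (s : ℝ≥0∞) ^ (n - 1 + k + m) * (ENNReal.ofReal c * σ) := by ring
      _ = (s : ℝ≥0∞) ^ (n - 1 + k + m) *
          ∫⁻ _ in Subtype.val '' η, ENNReal.ofReal c ∂surfaceAreaMeasure K := by
        rw [setLIntegral_const]
      _ ≤ (s : ℝ≥0∞) ^ (n - 1 + k + m) *
          ∫⁻ u in Subtype.val '' η, s * W u ∂surfaceAreaMeasure K := by
        gcongr _ * ?_
        exact setLIntegral_mono (hWm.const_mul _) hWlow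
      _ = (s : ℝ≥0∞) ^ (n - 1 + k + m + 1) *
          ∫⁻ u in Subtype.val '' η, W u ∂surfaceAreaMeasure K := by
        rw [lintegral_const_mul _ hWm]
        ring

/-- The local comparison fails only at `u = -e`, where `w = 0`. This point is null for the `L_p`
measure because the support function vanishes there, and for the Hausdorff measure because `m ≥ 1`.
-/
theorem hasDensityOn_coneBody {m k : ℕ} (hm : 1 ≤ m) (hL : Module.finrank ℝ L = m + 1)
    (hk : Module.finrank ℝ Lᗮ = k) (hn : 1 ≤ n) (hq2 : 1 / 2 < q) (hq1 : q < 1) {p : ℝ} (hp : p < 1)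
    (hqm : q * (m + 1 - p + k) = m) :
    HasDensityOn (lpSurfaceAreaMeasure p (coneBody L e he heL q hq)) m L fun u =>
      (lpConeDensity L q m k (1 + inner ℝ e ((u : Sphere n) : E n))).toNNReal := by
  have hw0 : ∀ u : subsphere L, 0 ≤ 1 + inner ℝ e ((u : Sphere n) : E n) :=
    fun u => one_add_inner_nonneg he (norm_eq_of_mem_sphere _)
  set N : Set (subsphere L) := {u | 1 + inner ℝ e ((u : Sphere n) : E n) = 0} with hN
  have hNm : MeasurableSet N :=
    (isClosed_eq (by fun_prop) continuous_const).measurableSet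
  refine eq_withDensity_of_locally (N := N) ?_ ?_ ?_ ?_ ?_
  · exact continuous_real_toNNReal.comp ((continuous_lpConeDensity m k).comp (by fun_prop))
  · exact fun u => Real.toNNReal_pos.2 (lpConeDensity_pos hq2 hq1 m k (hw0 u))
  · rw [lpSurfaceAreaMeasure_comap_apply p _ hNm]
    have hmeas : MeasurableSet (Subtype.val '' N) :=
      (MeasurableEmbedding.subtype_coe (measurableSet_subsphere L)).measurableSet_image.2 hNm
    rw [setLIntegral_congr_fun (g := fun _ => 0) hmeas, lintegral_zero]
    rintro _ ⟨u, hu, rfl⟩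
    change ENNReal.ofReal _ = 0
    rw [supportFunction_coneBody hq2 hq1.le u.2, show 1 + inner ℝ e ((u : Sphere n) : E n) = 0 from hu,
      Real.zero_rpow (by linarith), Real.zero_rpow (by linarith), ENNReal.ofReal_zero]
  · have hsub : N.Subsingleton := by
      have key : ∀ u ∈ N, ((u : Sphere n) : E n) = -e := fun u hu => by
        have h1 : ‖((u : Sphere n) : E n)‖ = 1 := norm_eq_of_mem_sphere _
        have h2 : ‖((u : Sphere n) : E n) + e‖ ^ 2 = 0 := by
          rw [@norm_add_sq_real, h1, he, real_inner_comm]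
          have : 1 + inner ℝ e ((u : Sphere n) : E n) = 0 := hu
          linarith
        exact eq_neg_of_add_eq_zero_left (norm_eq_zero.1 (pow_eq_zero_iff two_ne_zero |>.1 h2))
      exact fun u hu v hv => Subtype.ext (Subtype.ext ((key u hu).trans (key v hv).symm))
    have := Measure.nullSingletonClass_hausdorff (subsphere L) (d := m) (by exact_mod_cast hm)
    rw [Measure.euclideanHausdorffMeasure_def, Measure.smul_apply, hsub.measure_zero, smul_zero]
  · intro u hu r hr
    exact exists_nhds_lpSurfaceAreaMeasure_coneBody hm hL hk hn hq2 hq1 hqm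
      (lt_of_le_of_ne (hw0 u) (Ne.symm hu)) hr

theorem exists_continuous_density {m : ℕ} (hm : m + 2 ≤ n) {p : ℝ} (hp : p < 1)
    (hL : Module.finrank ℝ L = m + 1) (hnmp : (n : ℝ) - 2 * m - p < 0) :
    ∃ (K : ConvexBody (E n)) (φ : subsphere L → ℝ≥0), IsBodyWithOrigin K ∧
      (lpSurfaceAreaMeasure p K).support ⊆ subsphere L ∧
      HasDensityOn (lpSurfaceAreaMeasure p K) m L φ ∧ Continuous φ ∧ ∀ u, 0 < φ u := by
  obtain ⟨k, rfl⟩ : ∃ k, n = m + 1 + k := ⟨n - (m + 1), by omega⟩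
  have hk : Module.finrank ℝ Lᗮ = k := by
    have := L.finrank_add_finrank_orthogonal
    rw [finrank_euclideanSpace_fin] at this
    omega
  push_cast at hnmp
  have hk0 : (0 : ℝ) ≤ k := k.cast_nonneg
  -- The hypothesis reads `1 + k - p < m`, and `p < 1`.
  have hm0 : (0 : ℝ) < m := by linarith
  have hm1 : 1 ≤ m := by exact_mod_cast hm0
  have hden : 0 < (m : ℝ) + 1 - p + k := by linarith
  -- The denominator is `n - p`; `1/2 < q` is equivalent to `n - 2m - p < 0`, and `q < 1` to `p < k
  -- + 1`.
  set q := (m : ℝ) / (m + 1 - p + k) with hq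
  have hq1 : q < 1 := by
    rw [hq, div_lt_one hden]
    linarith
  have hq2 : 1 / 2 < q := by
    rw [hq, div_lt_div_iff₀ two_pos hden]
    linarith
  have hqm : q * (m + 1 - p + k) = m := div_mul_cancel₀ _ hden.ne'
  have : Nontrivial L := Module.nontrivial_of_finrank_pos (R := ℝ) (by omega)
  obtain ⟨e, he⟩ := exists_norm_eq L zero_le_one
  have he' : ‖(e : E (m + 1 + k))‖ = 1 := he
  have hw0 : ∀ u : subsphere L, 0 ≤ 1 + inner ℝ (e : E (m + 1 + k)) ((u : Sphere (m + 1 + k)) : E _) :=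
    fun u => one_add_inner_nonneg he' (norm_eq_of_mem_sphere _)
  refine ⟨coneBody L e he' e.2 q (by linarith), _, isBodyWithOrigin_coneBody hq1.le,
    lpSurfaceAreaMeasure_coneBody_support_subset hp,
    hasDensityOn_coneBody hm1 hL hk (by omega) hq2 hq1 hp hqm, ?_, ?_⟩
  · exact continuous_real_toNNReal.comp ((continuous_lpConeDensity m k).comp (by fun_prop))
  · exact fun u => Real.toNNReal_pos.2 (lpConeDensity_pos hq2 hq1 m k (hw0 u))

end LpSurface

theorem theorem1p4 (n m : ℕ) (hm : m + 2 ≤ n) (p : ℝ) (hp : p < 1)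
    (L : Submodule ℝ (LpSurface.E n)) (hL : Module.finrank ℝ L = m + 1) :
    (0 ≤ (n : ℝ) - 2 * (m : ℝ) - p →
      ∀ (K : ConvexBody (LpSurface.E n)) (φ : LpSurface.subsphere L → ℝ≥0),
        LpSurface.IsBodyWithOrigin K →
        (LpSurface.lpSurfaceAreaMeasure p K).support ⊆ LpSurface.subsphere L →
        Measurable φ →
        LpSurface.HasDensityOn (LpSurface.lpSurfaceAreaMeasure p K) m L φ →
        essInf (fun u => (φ u : ℝ≥0∞))
          (μHE[m] : MeasureTheory.Measure (LpSurface.subsphere L)) = 0) ∧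
    ((n : ℝ) - 2 * (m : ℝ) - p < 0 →
      ∃ (K : ConvexBody (LpSurface.E n)) (φ : LpSurface.subsphere L → ℝ≥0),
        LpSurface.IsBodyWithOrigin K ∧
        (LpSurface.lpSurfaceAreaMeasure p K).support ⊆ LpSurface.subsphere L ∧
        LpSurface.HasDensityOn (LpSurface.lpSurfaceAreaMeasure p K) m L φ ∧
        Continuous φ ∧ ∀ u, 0 < φ u) :=
  ⟨fun h _ _ hK hsupp _ hdens => LpSurface.essInf_density_eq_zero hm hp hL h hK hsupp hdens,
    LpSurface.exists_continuous_density hm hp hL⟩
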